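/- Let $V$ be a finite set, $H$ a Hermitian matrix on $\mathbb C^V$ with spectral projections $P_E$, $(A^a)_a$ a finite family of matrices closed under adjoints, $\beta>0$ an inverse temperature and $\sigma_E>0$ an energy resolution. Put $$f(t)=e^{-\sigma_E^2t^2}\sqrt{\sigma_E\sqrt{2/\pi}},\qquad \hat f(\omega)=\frac{1}{\sqrt{\sigma_E\sqrt{2\pi}}}\,e^{-\omega^2/(4\sigma_E^2)},\qquad \gamma(\omega)=\exp\!\Big(-\beta\max\big(\omega+\tfrac{\beta\sigma_E^2}{2},0\big)\Big),$$ $$\hat A^a(\omega)=\frac1{\sqrt{2\pi}}\int_{-\infty}^\infty e^{iHt}A^ae^{-iHt}e^{-i\omega t}f(t)\,dt,\qquad A^a_\nu=\sum_{E'-E=\nu}P_{E'}A^aP_E,$$ $$\theta(\nu_1,\nu_2)=\int_{-\infty}^\infty\hat f(\omega-\nu_1)\hat f(\omega-\nu_2)\gamma(\omega)\,d\omega,\qquad B=\sum_a\sum_{\nu_1,\nu_2}\frac{\tanh(-\beta(\nu_1-\nu_2)/4)}{2i}\,\theta(\nu_1,\nu_2)\,(A^a_{\nu_2})^\dagger A^a_{\nu_1},$$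 where $\nu_1,\nu_2$ range over the differences of eigenvalues of $H$. The CKG (Chen–Kastoryano–Gilyén) Lindbladian is the superoperator $$\mathcal L_\beta[X]=-i[B,X]+\sum_a\int_{-\infty}^\infty\gamma(\omega)\Big(\hat A^a(\omega)X\hat A^a(\omega)^\dagger-\tfrac12\{\hat A^a(\omega)^\dagger\hat A^a(\omega),X\}\Big)d\omega .$$ Its spectral gap is $\min_{j>1}|\lambda_j|$, where $\lambda_1=0,\lambda_2,\lambda_3,\dots$ are its eigenvalues listed with multiplicity. **Theorem.** For every fixed $\beta>0$ there exists a constant $\sigma_E>0$, independent of $n$, such that, for $H$ the adjacency matrix of the cyclic graph on $n$ vertices and the graph-local jump operators $A^a=n^{-1/2}|e_a\rangle\langle e_a|$, $a=1,\dots,n$, the spectral gap of the CKG Lindbladian $\mathcal L_\beta$ is $\Theta(n^{-3})$ as $n\to\infty$. -/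

import Mathlib

open Filter Asymptotics MeasureTheory
open scoped Matrix

noncomputable section

namespace CKG

variable {V : Type*} [Fintype V] [DecidableEq V]

/-! ### Scalar functions -/

/-- The Gaussian time window `f(t) = exp(-σ² t²) √(σ √(2/π))` of energy resolution `σ`. -/
def window (σ t : ℝ) : ℝ :=
  Real.exp (-σ ^ 2 * t ^ 2) * √(σ * √(2 / Real.pi))

/-- Its (unitary) Fourier transform `f̂(ω) = (σ √(2π))^{-1/2} exp(-ω² / (4σ²))`. -/
def windowHat (σ ω : ℝ) : ℝ :=
  1 / √(σ * √(2 * Real.pi)) * Real.exp (-ω ^ 2 / (4 * σ ^ 2))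

/-- The shifted Metropolis filter `γ(ω) = exp(-β max(ω + β σ² / 2, 0))`. -/
def filter (β σ ω : ℝ) : ℝ :=
  Real.exp (-β * max (ω + β * σ ^ 2 / 2) 0)

/-- `θ(ν₁, ν₂) = ∫ f̂(ω - ν₁) f̂(ω - ν₂) γ(ω) dω`. -/
def theta (β σ ν₁ ν₂ : ℝ) : ℝ :=
  ∫ ω : ℝ, windowHat σ (ω - ν₁) * windowHat σ (ω - ν₂) * filter β σ ω

/-! ### Bohr frequencies of a Hamiltonian -/

/-- The finite set of energies (real eigenvalues) of `H`. -/
def energies (H : Matrix V V ℂ) : Finset ℝ :=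
  (Matrix.finite_real_spectrum (A := H)).toFinset

/-- The spectral projection of the Hermitian matrix `H` at the energy `E`, i.e. the indicator
function of `{E}` applied to `H`; it is `0` if `E` is not an energy. -/
def energyProj (H : Matrix V V ℂ) (E : ℝ) : Matrix V V ℂ :=
  cfc (Set.indicator {E} (fun _ : ℝ => (1 : ℝ))) H

/-- The Bohr frequencies: all differences of energies. -/
def bohrFreqs (H : Matrix V V ℂ) : Finset ℝ :=
  Finset.image₂ (fun E E' => E - E') (energies H) (energies H)

/-- The component `A_ν` of `A` that raises the energy by exactly `ν`:
`A_ν = ∑_{E' - E = ν} P_{E'} A P_E`. -/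
def bohrComponent (H A : Matrix V V ℂ) (ν : ℝ) : Matrix V V ℂ :=
  ∑ E ∈ energies H, energyProj H (E + ν) * A * energyProj H E

/-! ### The CKG Lindbladian -/

/-- The Gaussian operator Fourier transform
`Â(ω) = (2π)^{-1/2} ∫ e^{iHt} A e^{-iHt} e^{-iωt} f(t) dt`, the integral being taken entrywise. -/
def operatorFT (σ : ℝ) (H A : Matrix V V ℂ) (ω : ℝ) : Matrix V V ℂ :=
  Matrix.of fun i j =>
    ((1 / √(2 * Real.pi) : ℝ) : ℂ) *
      ∫ t : ℝ,
        (NormedSpace.exp ((Complex.I * t) • H) * A * NormedSpace.exp ((-(Complex.I * t)) • H)) i j *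
          Complex.exp (-(Complex.I * ω * t)) * (window σ t : ℂ)

/-- The dissipator `X ↦ K X K† - (1/2) (K† K X + X K† K)` of a Lindblad operator `K`. -/
def dissipator (K : Matrix V V ℂ) : Module.End ℂ (Matrix V V ℂ) :=
  LinearMap.mulLeft ℂ K ∘ₗ LinearMap.mulRight ℂ Kᴴ -
    (1 / 2 : ℂ) • (LinearMap.mulLeft ℂ (Kᴴ * K) + LinearMap.mulRight ℂ (Kᴴ * K))

/-- The commutator superoperator `X ↦ B X - X B`. -/
def commutator (B : Matrix V V ℂ) : Module.End ℂ (Matrix V V ℂ) :=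
  LinearMap.mulLeft ℂ B - LinearMap.mulRight ℂ B

/-- The integral over `ω ∈ ℝ` of a superoperator-valued function, taken coefficientwise: it is the
superoperator whose value on the matrix unit `|k⟩⟨l|` has `(i, j)` entry
`∫ (F ω |k⟩⟨l|)_{ij} dω`. -/
def superIntegral (F : ℝ → Module.End ℂ (Matrix V V ℂ)) : Module.End ℂ (Matrix V V ℂ) :=
  (Matrix.stdBasis ℂ V V).constr ℂ fun p =>
    Matrix.of fun i j => ∫ ω : ℝ, F ω (Matrix.single p.1 p.2 1) i j

/-- The coherent term
`B = ∑_a ∑_{ν₁, ν₂} (tanh(-β (ν₁ - ν₂) / 4) / (2i)) θ(ν₁, ν₂) (A^a_{ν₂})† A^a_{ν₁}`. -/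
def coherentTerm {ι : Type*} [Fintype ι] (β σ : ℝ) (H : Matrix V V ℂ) (A : ι → Matrix V V ℂ) :
    Matrix V V ℂ :=
  ∑ a, ∑ ν₁ ∈ bohrFreqs H, ∑ ν₂ ∈ bohrFreqs H,
    ((Real.tanh (-β * (ν₁ - ν₂) / 4) * theta β σ ν₁ ν₂ : ℝ) / (2 * Complex.I) : ℂ) •
      ((bohrComponent H (A a) ν₂)ᴴ * bohrComponent H (A a) ν₁)

/-- The CKG Lindbladian with inverse temperature `β`, energy resolution `σ`, Hamiltonian `H` and
jump operators `A a`: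
`L[X] = -i [B, X] + ∑_a ∫ γ(ω) (Â^a(ω) X Â^a(ω)† - (1/2) {Â^a(ω)† Â^a(ω), X}) dω`. -/
def lindbladian {ι : Type*} [Fintype ι] (β σ : ℝ) (H : Matrix V V ℂ) (A : ι → Matrix V V ℂ) :
    Module.End ℂ (Matrix V V ℂ) :=
  (-Complex.I) • commutator (coherentTerm β σ H A) +
    ∑ a, superIntegral fun ω => (filter β σ ω : ℂ) • dissipator (operatorFT σ H (A a) ω)

/-- The spectral gap `min_{j > 1} |λ_j|`, where `λ_1 = 0, λ_2, λ_3, …` are the eigenvalues of `L`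
listed with algebraic multiplicity: one copy of the eigenvalue `0` (the one belonging to the Gibbs
state) is discarded. In particular the gap is `0` if `0` is a multiple eigenvalue. -/
def spectralGap (L : Module.End ℂ (Matrix V V ℂ)) : ℝ :=
  sInf {r : ℝ | ∃ z ∈ L.charpoly.roots.erase 0, r = ‖z‖}

/-! ### The cyclic graph with graph-local jumps -/

/-- The Hamiltonian of the cyclic graph on `n` vertices: its adjacency matrix. -/
def cycleHamiltonian (n : ℕ) : Matrix (Fin n) (Fin n) ℂ :=
  (SimpleGraph.cycleGraph n).adjMatrix ℂ

/-- The graph-local jump operators `A^a = n^{-1/2} |e_a⟩⟨e_a|`. -/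
def localJump (n : ℕ) (a : Fin n) : Matrix (Fin n) (Fin n) ℂ :=
  ((1 / √(n : ℝ) : ℝ) : ℂ) • Matrix.single a a 1

end CKG

end

namespace CKG

/-! ### The scalar functions -/

/-! The cycle is translation invariant, so the Fourier basis diagonalises `H`, and orthogonality of
characters makes the correlations of the local jumps equal to `n⁻²` when `p.1 - q.1 = p.2 - q.2` and
zero otherwise (`correlation_localJump`). Hence the coherent term vanishes (`coherentTerm_eq_zero`).
In the matrix units `|k⟩⟨l|` of the Fourier basis the Lindbladian becomes the real matrix
`rateMatrix`, which has nonnegative off-diagonal entries and preserves each sector `k - l`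
(`charpoly_lindbladian_cycle`).

A column sum of this matrix is `-n⁻²/2` times a sum over translations of the defects `θ(a,a) +
θ(b,b) - 2θ(a,b)`. On bounded frequencies each defect is the squared distance of two shifted
Gaussians, hence comparable to `(a - b)²` (`theta_defect_le`, `exists_le_theta_defect`). Off the
sector `k = l` these squares sum to at least `2/n`, and in the sector `k - l = 1` to `O(1/n)`.
Decoherence therefore sets the scale `n⁻² · n⁻¹ = n⁻³`.

The populations `k = l` relax faster, at a rate of at least order `1/n`, since all their transition
rates are of order `n⁻²` at least. To see this, a small multiple of the Gibbs vector times the trace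
functional is subtracted. This rank one correction only moves one eigenvalue `0`
(`charpoly_sub_vecMulVec`) and keeps off-diagonal entries nonnegative. Gershgorin's bound on columns
then gives the lower bound on the gap.

For the upper bound, detailed balance (`theta_neg`) makes the deflated matrix symmetrisable, and the
Rayleigh principle on the sector `k - l = 1` produces a real eigenvalue of size `O(n⁻³)`. -/

theorem filter_pos (β σ ω : ℝ) : 0 < filter β σ ω := Real.exp_pos _

theorem filter_le_one {β : ℝ} (hβ : 0 ≤ β) (σ ω : ℝ) : filter β σ ω ≤ 1 := by
  unfold filter
  rw [Real.exp_le_one_iff, neg_mul, neg_nonpos]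
  positivity

theorem continuous_filter (β σ : ℝ) : Continuous (filter β σ) := by
  unfold filter
  fun_prop

theorem windowHat_pos {σ : ℝ} (hσ : 0 < σ) (ω : ℝ) : 0 < windowHat σ ω := by
  unfold windowHat
  have := Real.pi_pos
  positivity

theorem windowHat_neg (σ ω : ℝ) : windowHat σ (-ω) = windowHat σ ω := by
  simp [windowHat]

/-- Completing the square: the overlap of the two Gaussians depends only on `a - b`, and what
remains is a Gaussian centred at the midpoint. -/
theorem windowHat_mul {σ : ℝ} (hσ : 0 < σ) (a b ω : ℝ) :
    windowHat σ (ω - a) * windowHat σ (ω - b) =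
      1 / (σ * √(2 * Real.pi)) * Real.exp (-(a - b) ^ 2 / (8 * σ ^ 2)) *
        Real.exp (-(1 / (2 * σ ^ 2)) * (ω - (a + b) / 2) ^ 2) := by
  unfold windowHat
  have h : √(σ * √(2 * Real.pi)) * √(σ * √(2 * Real.pi)) = σ * √(2 * Real.pi) :=
    Real.mul_self_sqrt (by positivity)
  rw [mul_mul_mul_comm, div_mul_div_comm, h, one_mul, ← Real.exp_add, mul_assoc, ← Real.exp_add]
  congr 2
  field_simp
  ring

theorem integrable_windowHat_mul {σ : ℝ} (hσ : 0 < σ) (a b : ℝ) :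
    Integrable fun ω => windowHat σ (ω - a) * windowHat σ (ω - b) := by
  simp_rw [windowHat_mul hσ]
  exact ((integrable_exp_neg_mul_sq (b := 1 / (2 * σ ^ 2)) (by positivity)).comp_sub_right
    ((a + b) / 2)).const_mul _

theorem integral_windowHat_mul {σ : ℝ} (hσ : 0 < σ) (a b : ℝ) :
    ∫ ω, windowHat σ (ω - a) * windowHat σ (ω - b) = Real.exp (-(a - b) ^ 2 / (8 * σ ^ 2)) := by
  simp_rw [windowHat_mul hσ]
  rw [integral_const_mul,
    integral_sub_right_eq_self (fun ω => Real.exp (-(1 / (2 * σ ^ 2)) * ω ^ 2)), integral_gaussian]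
  have h : √(Real.pi / (1 / (2 * σ ^ 2))) = σ * √(2 * Real.pi) := by
    rw [show Real.pi / (1 / (2 * σ ^ 2)) = σ ^ 2 * (2 * Real.pi) by field_simp,
      Real.sqrt_mul (by positivity), Real.sqrt_sq hσ.le]
  have : 0 < σ * √(2 * Real.pi) := by have := Real.pi_pos; positivity
  rw [h]
  field_simp

theorem integrable_theta {β σ : ℝ} (hβ : 0 ≤ β) (hσ : 0 < σ) (a b : ℝ) :
    Integrable fun ω => windowHat σ (ω - a) * windowHat σ (ω - b) * filter β σ ω := by
  refine (integrable_windowHat_mul hσ a b).mul_bdd (c := 1)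
    (continuous_filter β σ).aestronglyMeasurable (ae_of_all _ fun ω => ?_)
  rw [Real.norm_of_nonneg (filter_pos β σ ω).le]
  exact filter_le_one hβ σ ω

theorem theta_nonneg {β σ : ℝ} (hσ : 0 < σ) (a b : ℝ) : 0 ≤ theta β σ a b :=
  integral_nonneg fun ω => mul_nonneg
    (mul_pos (windowHat_pos hσ _) (windowHat_pos hσ _)).le (filter_pos β σ ω).le

theorem theta_comm (β σ a b : ℝ) : theta β σ a b = theta β σ b a := by
  unfold theta
  simp_rw [mul_comm (windowHat σ (_ - a))]

/-- The quadratic Cauchy–Schwarz defect of `theta`. -/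
theorem theta_defect {β σ : ℝ} (hβ : 0 ≤ β) (hσ : 0 < σ) (a b : ℝ) :
    theta β σ a a + theta β σ b b - 2 * theta β σ a b =
      ∫ ω, (windowHat σ (ω - a) - windowHat σ (ω - b)) ^ 2 * filter β σ ω := by
  unfold theta
  rw [← integral_const_mul, ← integral_add (integrable_theta hβ hσ a a) (integrable_theta hβ hσ b b),
    ← integral_sub]
  · congr 1
    ext ω
    ring
  · exact (integrable_theta hβ hσ a a).add (integrable_theta hβ hσ b b)
  · exact (integrable_theta hβ hσ a b).const_mul 2

theorem integrable_sq_sub {β σ : ℝ} (hβ : 0 ≤ β) (hσ : 0 < σ) (a b : ℝ) :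
    Integrable fun ω => (windowHat σ (ω - a) - windowHat σ (ω - b)) ^ 2 * filter β σ ω := by
  convert ((integrable_theta hβ hσ a a).add (integrable_theta hβ hσ b b)).sub
      ((integrable_theta hβ hσ a b).const_mul 2) using 1
  ext ω
  simp only [Pi.add_apply, Pi.sub_apply]
  ring

/-- Since the filter is at most `1`, the defect is bounded by the unweighted `L²` distance `2(1 -
e^{-x})` with `x = (a - b)²/(8σ²)`, and `1 - e^{-x} ≤ x`. -/
theorem theta_defect_le {β σ : ℝ} (hβ : 0 ≤ β) (hσ : 0 < σ) (a b : ℝ) :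
    theta β σ a a + theta β σ b b - 2 * theta β σ a b ≤ 1 / (4 * σ ^ 2) * (a - b) ^ 2 := by
  rw [theta_defect hβ hσ]
  have hint := ((integrable_windowHat_mul hσ a a).add (integrable_windowHat_mul hσ b b)).sub
      ((integrable_windowHat_mul hσ a b).const_mul 2)
  refine (integral_mono (integrable_sq_sub hβ hσ a b) hint fun ω => ?_).trans ?_
  · refine (mul_le_of_le_one_right (sq_nonneg _) (filter_le_one hβ σ ω)).trans (le_of_eq ?_)
    simp only [Pi.add_apply, Pi.sub_apply]
    ring
  · rw [integral_sub' ((integrable_windowHat_mul hσ a a).add (integrable_windowHat_mul hσ b b))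
      ((integrable_windowHat_mul hσ a b).const_mul 2),
      integral_add' (integrable_windowHat_mul hσ a a) (integrable_windowHat_mul hσ b b),
      integral_const_mul, integral_windowHat_mul hσ, integral_windowHat_mul hσ,
      integral_windowHat_mul hσ]
    have h := Real.add_one_le_exp (-(a - b) ^ 2 / (8 * σ ^ 2))
    have h2 : 1 / (4 * σ ^ 2) * (a - b) ^ 2 = -2 * (-(a - b) ^ 2 / (8 * σ ^ 2)) := by
      field_simp
      ring
    simp only [sub_self, ne_eq, OfNat.ofNat_ne_zero, not_false_eq_true, zero_pow, neg_zero,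
      zero_div, Real.exp_zero]
    linarith

/-- A nonnegative integrable function that is at least `c` on a unit interval has integral at
least `c`. -/
theorem le_integral_of_le_on_unit {f : ℝ → ℝ} {c x : ℝ} (hf : Integrable f) (h0 : ∀ ω, 0 ≤ f ω)
    (hc : ∀ ω ∈ Set.Icc x (x + 1), c ≤ f ω) : c ≤ ∫ ω, f ω :=
  calc c = ∫ _ in Set.Icc x (x + 1), c := by simp
    _ ≤ ∫ ω in Set.Icc x (x + 1), f ω :=
        setIntegral_mono_on (by simp) hf.integrableOn measurableSet_Icc hc
    _ ≤ ∫ ω, f ω := setIntegral_le_integral hf (ae_of_all _ h0)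

theorem le_filter {β σ ω R : ℝ} (hβ : 0 ≤ β) (h : ω ≤ R) : filter β σ R ≤ filter β σ ω := by
  unfold filter
  refine Real.exp_le_exp.2 ?_
  have : max (ω + β * σ ^ 2 / 2) 0 ≤ max (R + β * σ ^ 2 / 2) 0 := by gcongr
  nlinarith

theorem exists_le_theta_self {β σ : ℝ} (hβ : 0 ≤ β) (hσ : 0 < σ) (R : ℝ) :
    ∃ c, 0 < c ∧ ∀ ν, |ν| ≤ R → c ≤ theta β σ ν ν := by
  -- For `ω` in `[0, 1]` and `|ν| ≤ R` one has `|ω - ν| ≤ 1 + R` and `ω ≤ 1`, so this constant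
  -- bounds the integrand from below there.
  refine ⟨windowHat σ (1 + R) * windowHat σ (1 + R) * filter β σ 1,
    mul_pos (mul_pos (windowHat_pos hσ _) (windowHat_pos hσ _)) (filter_pos _ _ _), fun ν hν => ?_⟩
  refine le_integral_of_le_on_unit (x := 0) (integrable_theta hβ hσ ν ν)
    (fun ω => mul_nonneg (mul_pos (windowHat_pos hσ _) (windowHat_pos hσ _)).le
      (filter_pos β σ ω).le) fun ω hω => ?_
  rw [zero_add, Set.mem_Icc] at hω
  obtain ⟨h1, h2⟩ := abs_le.1 hν
  have hw : windowHat σ (1 + R) ≤ windowHat σ (ω - ν) := by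
    unfold windowHat
    have h : (ω - ν) ^ 2 ≤ (1 + R) ^ 2 := sq_le_sq' (by linarith) (by linarith)
    gcongr
  have h0 := windowHat_pos hσ (1 + R)
  have hf := filter_pos β σ 1
  exact mul_le_mul (mul_le_mul hw hw h0.le (h0.le.trans hw)) (le_filter hβ (by linarith)) hf.le
    (mul_nonneg (h0.le.trans hw) (h0.le.trans hw))

/-- Past `1` the Gaussian falls at a definite rate: `y² - x² ≥ 2(y - x)` there, and `e^u - 1 ≥ u`
converts this into a linear bound. -/
theorem windowHat_sub_ge {σ R x y : ℝ} (hσ : 0 < σ) (hx : 1 ≤ x) (hxy : x ≤ y) (hy : y ≤ R) :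
    windowHat σ R / (2 * σ ^ 2) * (y - x) ≤ windowHat σ x - windowHat σ y := by
  unfold windowHat
  have h1 : Real.exp (-x ^ 2 / (4 * σ ^ 2)) =
      Real.exp (-y ^ 2 / (4 * σ ^ 2)) * Real.exp ((y ^ 2 - x ^ 2) / (4 * σ ^ 2)) := by
    rw [← Real.exp_add]
    congr 1
    ring
  have h2 : (y - x) / (2 * σ ^ 2) ≤ Real.exp ((y ^ 2 - x ^ 2) / (4 * σ ^ 2)) - 1 := by
    refine le_trans ?_ (le_sub_iff_add_le.2 (Real.add_one_le_exp _))
    rw [div_le_div_iff₀ (by positivity) (by positivity)]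
    have : 2 * (y - x) ≤ y ^ 2 - x ^ 2 := by nlinarith
    have h3 : 0 ≤ 2 * σ ^ 2 := by positivity
    nlinarith
  have h3 : Real.exp (-R ^ 2 / (4 * σ ^ 2)) ≤ Real.exp (-y ^ 2 / (4 * σ ^ 2)) := by
    gcongr
    linarith
  have h4 : 0 ≤ (y - x) / (2 * σ ^ 2) := div_nonneg (by linarith) (by positivity)
  rw [h1]
  calc _ = 1 / √(σ * √(2 * Real.pi)) *
        (Real.exp (-R ^ 2 / (4 * σ ^ 2)) * ((y - x) / (2 * σ ^ 2))) := by ring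
    _ ≤ 1 / √(σ * √(2 * Real.pi)) * (Real.exp (-y ^ 2 / (4 * σ ^ 2)) *
        (Real.exp ((y ^ 2 - x ^ 2) / (4 * σ ^ 2)) - 1)) := by gcongr
    _ = _ := by ring

theorem exists_le_theta_defect {β σ : ℝ} (hβ : 0 ≤ β) (hσ : 0 < σ) (R : ℝ) :
    ∃ c, 0 < c ∧ ∀ a b, |a| ≤ R → |b| ≤ R →
      c * (a - b) ^ 2 ≤ theta β σ a a + theta β σ b b - 2 * theta β σ a b := by
  have hw := windowHat_pos hσ (2 * R + 2)
  refine ⟨(windowHat σ (2 * R + 2) / (2 * σ ^ 2)) ^ 2 * filter β σ (R + 2),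
    mul_pos (by positivity) (filter_pos _ _ _), ?_⟩
  have key : ∀ a b, a ≤ b → |a| ≤ R → |b| ≤ R →
      (windowHat σ (2 * R + 2) / (2 * σ ^ 2)) ^ 2 * filter β σ (R + 2) * (a - b) ^ 2 ≤
        theta β σ a a + theta β σ b b - 2 * theta β σ a b := by
    intro a b hab ha hb
    rw [theta_defect hβ hσ]
    -- For `ω` in `[R + 1, R + 2]` both `ω - a` and `ω - b` lie in `[1, 2R + 2]`, on the same
    -- decreasing flank of the Gaussian.
    refine le_integral_of_le_on_unit (x := R + 1) (integrable_sq_sub hβ hσ a b)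
      (fun ω => mul_nonneg (sq_nonneg _) (filter_pos β σ ω).le) fun ω hω => ?_
    rw [Set.mem_Icc] at hω
    obtain ⟨ha1, ha2⟩ := abs_le.1 ha
    obtain ⟨hb1, hb2⟩ := abs_le.1 hb
    have h1 := windowHat_sub_ge (σ := σ) (R := 2 * R + 2) (x := ω - b) (y := ω - a) hσ
      (by linarith) (by linarith) (by linarith)
    have h2 : 0 ≤ windowHat σ (2 * R + 2) / (2 * σ ^ 2) * (ω - a - (ω - b)) :=
      mul_nonneg (by positivity) (by linarith)
    calc _ = (windowHat σ (2 * R + 2) / (2 * σ ^ 2) * (ω - a - (ω - b))) ^ 2 *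
          filter β σ (R + 2) := by ring
      _ ≤ (windowHat σ (ω - b) - windowHat σ (ω - a)) ^ 2 * filter β σ ω := by
          have := filter_pos β σ (R + 2)
          gcongr
          exact le_filter hβ (by linarith)
      _ = _ := by ring
  intro a b ha hb
  rcases le_total a b with hab | hab
  · exact key a b hab ha hb
  · have h := key b a hab hb ha
    rw [theta_comm β σ b a] at h
    linarith [sub_sq_comm a b]

/-- The detailed balance relation of the rates. -/
theorem theta_neg {β σ : ℝ} (hσ : 0 < σ) (a b : ℝ) :
    theta β σ (-a) (-b) = Real.exp (β * (a + b) / 2) * theta β σ a b := by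
  unfold theta
  -- The substitution `ω ↦ -(ω + βσ²)` reflects the filter about its kink at `-βσ²/2`. It reproduces
  -- the filter up to an exponential, which the shift of the Gaussian centre absorbs.
  rw [← integral_neg_eq_self, ← integral_add_right_eq_self _ (β * σ ^ 2), ← integral_const_mul]
  congr 1
  ext ω
  have h1 : ∀ c, windowHat σ (-(ω + β * σ ^ 2) - -c) = windowHat σ (ω - (c - β * σ ^ 2)) := by
    intro c
    rw [← windowHat_neg]
    congr 1
    ring
  have h2 : filter β σ (-(ω + β * σ ^ 2)) =
      Real.exp (β * (ω + β * σ ^ 2 / 2)) * filter β σ ω := by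
    unfold filter
    rw [← Real.exp_add]
    congr 1
    rcases le_total (ω + β * σ ^ 2 / 2) 0 with h | h
    · rw [max_eq_right h, max_eq_left (by linarith)]
      ring
    · rw [max_eq_left h, max_eq_right (by linarith)]
      ring
  rw [h1, h1, h2, windowHat_mul hσ, windowHat_mul hσ]
  have h3 : Real.exp (-(1 / (2 * σ ^ 2)) * (ω - (a - β * σ ^ 2 + (b - β * σ ^ 2)) / 2) ^ 2) *
      Real.exp (β * (ω + β * σ ^ 2 / 2)) = Real.exp (β * (a + b) / 2) *
        Real.exp (-(1 / (2 * σ ^ 2)) * (ω - (a + b) / 2) ^ 2) := by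
    rw [← Real.exp_add, ← Real.exp_add]
    congr 1
    field_simp
    ring
  rw [show a - β * σ ^ 2 - (b - β * σ ^ 2) = a - b by ring]
  linear_combination (1 / (σ * √(2 * Real.pi)) * Real.exp (-(a - b) ^ 2 / (8 * σ ^ 2))) *
    filter β σ ω * h3

end CKG

namespace CKG

variable {V : Type*} [Fintype V] [DecidableEq V]

/-! ### Functions of a diagonalised Hamiltonian -/

theorem spectrum_conj_diagonal {U : Matrix V V ℂ} (hU : U ∈ unitary (Matrix V V ℂ)) (E : V → ℝ) :
    spectrum ℝ (U * Matrix.diagonal (fun k => (E k : ℂ)) * Uᴴ) = Set.range E := by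
  have h := Unitary.spectrum_star_right_conjugate (R := ℝ)
    (a := Matrix.diagonal (fun k => (E k : ℂ))) (U := ⟨U, hU⟩)
  refine h.trans ?_
  ext x
  rw [← spectrum.algebraMap_mem_iff ℂ, spectrum_diagonal]
  simp

/-- The spectrum is finite, so `f` agrees on it with an interpolating polynomial, and polynomials
pass through conjugation and diagonals. This covers the discontinuous indicators defining the
spectral projections. -/
theorem cfc_conj_diagonal {U : Matrix V V ℂ} (hU : U ∈ unitary (Matrix V V ℂ)) (E : V → ℝ)
    (f : ℝ → ℝ) :
    cfc f (U * Matrix.diagonal (fun k => (E k : ℂ)) * Uᴴ) =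
      U * Matrix.diagonal (fun k => (f (E k) : ℂ)) * Uᴴ := by
  set H := U * Matrix.diagonal (fun k => (E k : ℂ)) * Uᴴ with hH
  have hsa : IsSelfAdjoint H := by
    rw [hH, IsSelfAdjoint, Matrix.star_eq_conjTranspose]
    simp only [Matrix.conjTranspose_mul, Matrix.conjTranspose_conjTranspose,
      Matrix.diagonal_conjTranspose, mul_assoc]
    congr 3
    ext k
    simp
  set p := Lagrange.interpolate (Finset.univ.image E) id f with hp
  have heval : ∀ k, p.eval (E k) = f (E k) := fun k =>
    Lagrange.eval_interpolate_at_node (v := id) f (Function.injective_id.injOn)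
      (Finset.mem_image_of_mem E (Finset.mem_univ k))
  have h1 : cfc f H = cfc (fun x => p.eval x) H := by
    refine cfc_congr ?_
    rw [hH, spectrum_conj_diagonal hU]
    rintro _ ⟨k, rfl⟩
    exact (heval k).symm
  have h2 : Polynomial.aeval (fun k => (E k : ℂ)) p = fun k => (f (E k) : ℂ) := by
    ext k
    rw [← heval k]
    have := Polynomial.aeval_algHom_apply (Pi.evalAlgHom ℝ (fun _ : V => ℂ) k)
      (fun k => (E k : ℂ)) p
    simp only [Pi.evalAlgHom_apply] at this
    rw [← this]
    exact Polynomial.aeval_algebraMap_apply ℂ (E k) p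
  have h3 := Polynomial.aeval_algHom_apply (Matrix.diagonalAlgHom (n := V) (α := ℂ) ℝ)
      (fun k => (E k : ℂ)) p
  have h4 := Polynomial.aeval_algHom_apply
    (Unitary.conjStarAlgAut ℝ (Matrix V V ℂ) ⟨U, hU⟩)
    (Matrix.diagonal (fun k => (E k : ℂ))) p
  rw [h2] at h3
  rw [h1, cfc_polynomial p H hsa]
  refine h4.trans ?_
  exact congrArg (fun M => U * M * Uᴴ) h3

theorem exp_conj_diagonal {U : Matrix V V ℂ} (hU : U ∈ unitary (Matrix V V ℂ)) (E : V → ℝ)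
    (c : ℂ) :
    NormedSpace.exp (c • (U * Matrix.diagonal (fun k => (E k : ℂ)) * Uᴴ)) =
      U * Matrix.diagonal (fun k => Complex.exp (c * E k)) * Uᴴ := by
  have h1 : U * Uᴴ = 1 := (Unitary.mem_iff.1 hU).2
  have hinv : U⁻¹ = Uᴴ := Matrix.inv_eq_right_inv h1
  have hunit : IsUnit U := IsUnit.of_mul_eq_one _ h1
  rw [← hinv, ← Matrix.smul_mul, ← Matrix.mul_smul, Matrix.exp_conj _ _ hunit,
    ← Matrix.diagonal_smul, Matrix.exp_diagonal]
  congr 3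
  ext k
  rw [Pi.coe_exp]
  simp [Complex.exp_eq_exp_ℂ]

/-! ### Transition components -/

/-- The component of `A` between two vectors of the eigenbasis `U`. -/
def pairComponent (U A : Matrix V V ℂ) (p : V × V) : Matrix V V ℂ :=
  U * Matrix.single p.1 p.2 ((Uᴴ * A * U) p.1 p.2) * Uᴴ

theorem diagonal_mul_mul_diagonal_eq_sum (d e : V → ℂ) (M : Matrix V V ℂ) :
    Matrix.diagonal d * M * Matrix.diagonal e =
      ∑ p : V × V, (d p.1 * e p.2) • Matrix.single p.1 p.2 (M p.1 p.2) := by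
  rw [Fintype.sum_prod_type]
  conv_lhs => rw [Matrix.matrix_eq_sum_single (Matrix.diagonal d * M * Matrix.diagonal e)]
  refine Finset.sum_congr rfl fun i _ => Finset.sum_congr rfl fun j _ => ?_
  rw [Matrix.mul_diagonal, Matrix.diagonal_mul, Matrix.smul_single, smul_eq_mul]
  congr 1
  ring

theorem conj_diagonal_mul_mul (U A : Matrix V V ℂ) (d e : V → ℂ) :
    (U * Matrix.diagonal d * Uᴴ) * A * (U * Matrix.diagonal e * Uᴴ) =
      ∑ p : V × V, (d p.1 * e p.2) • pairComponent U A p := by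
  have : (U * Matrix.diagonal d * Uᴴ) * A * (U * Matrix.diagonal e * Uᴴ) =
      U * (Matrix.diagonal d * (Uᴴ * A * U) * Matrix.diagonal e) * Uᴴ := by
    simp only [mul_assoc]
  rw [this, diagonal_mul_mul_diagonal_eq_sum, Finset.mul_sum, Finset.sum_mul]
  simp only [pairComponent, Matrix.mul_smul, Matrix.smul_mul]

theorem fourier_window {σ : ℝ} (hσ : 0 < σ) (ν ω : ℝ) :
    ((1 / √(2 * Real.pi) : ℝ) : ℂ) *
      ∫ t : ℝ, Complex.exp (Complex.I * t * ν) * Complex.exp (-(Complex.I * ω * t)) * window σ t =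
      windowHat σ (ω - ν) := by
  have h1 : ∀ t : ℝ, Complex.exp (Complex.I * t * ν) * Complex.exp (-(Complex.I * ω * t)) *
      window σ t = (√(σ * √(2 / Real.pi)) : ℝ) * (Complex.exp (Complex.I * ((ν - ω : ℝ) : ℂ) * t) *
        Complex.exp (-((σ ^ 2 : ℝ) : ℂ) * t ^ 2)) := by
    intro t
    unfold CKG.window
    push_cast
    rw [← Complex.exp_add, ← Complex.exp_add, mul_comm _ ((√(σ * √(2 / Real.pi)) : ℝ) : ℂ),
      mul_left_comm, ← Complex.exp_add]
    congr 2
    ring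
  simp_rw [h1]
  rw [integral_const_mul, fourierIntegral_gaussian (by rw [Complex.ofReal_re]; positivity)]
  have h2 : ((Real.pi : ℂ) / ((σ ^ 2 : ℝ) : ℂ)) ^ (1 / 2 : ℂ) = ((√(Real.pi / σ ^ 2) : ℝ) : ℂ) := by
    rw [Real.sqrt_eq_rpow, Complex.ofReal_cpow (by positivity)]
    push_cast
    rfl
  have h3 : Complex.exp (-((ν - ω : ℝ) : ℂ) ^ 2 / (4 * ((σ ^ 2 : ℝ) : ℂ))) =
      ((Real.exp (-(ω - ν) ^ 2 / (4 * σ ^ 2)) : ℝ) : ℂ) := by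
    push_cast
    congr 1
    ring
  rw [h2, h3, windowHat, ← Complex.ofReal_mul, ← Complex.ofReal_mul, ← Complex.ofReal_mul,
    ← mul_assoc, ← mul_assoc]
  congr 2
  have hpi := Real.pi_pos
  rw [one_div, one_div, ← Real.sqrt_inv, ← Real.sqrt_mul (by positivity),
    ← Real.sqrt_mul (by positivity), ← Real.sqrt_inv]
  congr 1
  -- This identity matches the normalisations of the two windows.
  have h4 : √(2 * Real.pi) * √(2 / Real.pi) = 2 := by
    rw [← Real.sqrt_mul (by positivity), show 2 * Real.pi * (2 / Real.pi) = 2 ^ 2 by field_simp,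
      Real.sqrt_sq (by norm_num)]
  have h5 : 0 < √(2 * Real.pi) := by positivity
  field_simp
  linear_combination h4

theorem integrable_fourier_window {σ : ℝ} (hσ : 0 < σ) (ν ω : ℝ) :
    Integrable fun t : ℝ =>
      Complex.exp (Complex.I * t * ν) * Complex.exp (-(Complex.I * ω * t)) * window σ t := by
  have h : Integrable fun t : ℝ => (window σ t : ℂ) := by
    refine Integrable.ofReal ?_
    exact (integrable_exp_neg_mul_sq (b := σ ^ 2) (by positivity)).mul_const _
  refine h.bdd_mul (c := 1) (by fun_prop : Continuous _).aestronglyMeasurable (ae_of_all _ fun t => ?_)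
  rw [norm_mul, Complex.norm_exp, Complex.norm_exp]
  simp

/-- In the Heisenberg picture the component between eigenvectors `k` and `l` only acquires the phase
`e^{i(E k - E l)t}`, so its Fourier transform is the window shifted by that Bohr frequency. -/
theorem operatorFT_eq_sum {σ : ℝ} (hσ : 0 < σ) {U : Matrix V V ℂ}
    (hU : U ∈ unitary (Matrix V V ℂ)) (E : V → ℝ) (A : Matrix V V ℂ) (ω : ℝ) :
    operatorFT σ (U * Matrix.diagonal (fun k => (E k : ℂ)) * Uᴴ) A ω =
      ∑ p : V × V, (windowHat σ (ω - (E p.1 - E p.2)) : ℂ) • pairComponent U A p := by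
  ext i j
  simp only [operatorFT, Matrix.of_apply, exp_conj_diagonal hU, conj_diagonal_mul_mul,
    Matrix.sum_apply, Matrix.smul_apply, smul_eq_mul]
  have h : ∀ t : ℝ, (∑ p : V × V, Complex.exp (Complex.I * t * E p.1) *
      Complex.exp (-(Complex.I * t) * E p.2) * pairComponent U A p i j) *
        Complex.exp (-(Complex.I * ω * t)) * window σ t =
      ∑ p : V × V, Complex.exp (Complex.I * t * ((E p.1 - E p.2 : ℝ) : ℂ)) *
        Complex.exp (-(Complex.I * ω * t)) * window σ t * pairComponent U A p i j := by
    intro t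
    rw [Finset.sum_mul, Finset.sum_mul]
    refine Finset.sum_congr rfl fun p _ => ?_
    rw [← Complex.exp_add]
    push_cast
    rw [show Complex.I * t * E p.1 + -(Complex.I * t) * E p.2 =
      Complex.I * t * (E p.1 - E p.2) by ring]
    ring
  simp_rw [h]
  rw [integral_finsetSum _ fun p _ => (integrable_fourier_window hσ _ ω).mul_const _,
    Finset.mul_sum]
  refine Finset.sum_congr rfl fun p _ => ?_
  rw [integral_mul_const, ← mul_assoc, fourier_window hσ]

theorem mem_energies {U : Matrix V V ℂ} (hU : U ∈ unitary (Matrix V V ℂ)) (E : V → ℝ) (k : V) :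
    E k ∈ energies (U * Matrix.diagonal (fun k => (E k : ℂ)) * Uᴴ) := by
  rw [energies, Set.Finite.mem_toFinset, spectrum_conj_diagonal hU]
  exact Set.mem_range_self k

theorem bohrComponent_eq_sum {U : Matrix V V ℂ} (hU : U ∈ unitary (Matrix V V ℂ)) (E : V → ℝ)
    (A : Matrix V V ℂ) (ν : ℝ) :
    bohrComponent (U * Matrix.diagonal (fun k => (E k : ℂ)) * Uᴴ) A ν =
      ∑ p : V × V, if E p.1 - E p.2 = ν then pairComponent U A p else 0 := by
  simp only [bohrComponent, energyProj, cfc_conj_diagonal hU, conj_diagonal_mul_mul]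
  rw [Finset.sum_comm]
  refine Finset.sum_congr rfl fun p _ => ?_
  rw [Finset.sum_eq_single (E p.2)]
  · simp only [Set.indicator_apply, Set.mem_singleton_iff, if_true, sub_eq_iff_eq_add']
    split_ifs <;> simp
  · intro x _ hx
    simp [Set.indicator_apply, hx.symm]
  · exact fun h => absurd (mem_energies hU E p.2) h

/-- The correlations between matrix elements of the jump operators in the basis `U`. -/
def correlation {ι : Type*} [Fintype ι] (U : Matrix V V ℂ) (A : ι → Matrix V V ℂ)
    (p q : V × V) : ℂ :=
  ∑ a, (Uᴴ * A a * U) p.1 p.2 * star ((Uᴴ * A a * U) q.1 q.2)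

theorem conjTranspose_pairComponent_mul {U : Matrix V V ℂ} (hU : U ∈ unitary (Matrix V V ℂ))
    (A : Matrix V V ℂ) (p q : V × V) :
    (pairComponent U A q)ᴴ * pairComponent U A p =
      if p.1 = q.1 then ((Uᴴ * A * U) p.1 p.2 * star ((Uᴴ * A * U) q.1 q.2)) •
        (U * Matrix.single q.2 p.2 1 * Uᴴ) else 0 := by
  have h1 : Uᴴ * U = 1 := (Unitary.mem_iff.1 hU).1
  simp only [pairComponent, Matrix.conjTranspose_mul, Matrix.conjTranspose_conjTranspose,
    Matrix.conjTranspose_single]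
  have : ∀ X Y : Matrix V V ℂ, U * (X * Uᴴ) * (U * Y * Uᴴ) = U * (X * Y) * Uᴴ := by
    intro X Y
    calc _ = U * X * (Uᴴ * U) * Y * Uᴴ := by simp only [mul_assoc]
      _ = _ := by rw [h1]; simp only [mul_assoc, one_mul]
  rw [this]
  split_ifs with h
  · rw [h, Matrix.single_mul_single_same, ← Matrix.smul_mul, ← Matrix.mul_smul,
      Matrix.smul_single, smul_eq_mul, mul_one, mul_comm]
  · rw [Matrix.single_mul_single_of_ne _ _ _ _ (Ne.symm h)]
    simp

/-- The product of two components forces a common final index `k`, so only correlations of `(k, l)`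
with `(k, l')` enter. They vanish for `l ≠ l'`, while `l = l'` gives equal Bohr frequencies and
`tanh 0 = 0`. -/
theorem coherentTerm_eq_zero {ι : Type*} [Fintype ι] {U : Matrix V V ℂ}
    (hU : U ∈ unitary (Matrix V V ℂ)) (E : V → ℝ) (A : ι → Matrix V V ℂ) (β σ : ℝ)
    (hA : ∀ k l l', l ≠ l' → correlation U A (k, l) (k, l') = 0) :
    coherentTerm β σ (U * Matrix.diagonal (fun k => (E k : ℂ)) * Uᴴ) A = 0 := by
  set H := U * Matrix.diagonal (fun k => (E k : ℂ)) * Uᴴ with hH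
  set c : ℝ → ℝ → ℂ := fun ν₁ ν₂ =>
    ((Real.tanh (-β * (ν₁ - ν₂) / 4) * theta β σ ν₁ ν₂ : ℝ) / (2 * Complex.I) : ℂ) with hc
  have hbohr : ∀ p : V × V, E p.1 - E p.2 ∈ bohrFreqs H := fun p =>
    Finset.mem_image₂_of_mem (mem_energies hU E p.1) (mem_energies hU E p.2)
  have h1 : ∀ a, ∑ ν₁ ∈ bohrFreqs H, ∑ ν₂ ∈ bohrFreqs H,
      c ν₁ ν₂ • ((bohrComponent H (A a) ν₂)ᴴ * bohrComponent H (A a) ν₁) =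
      ∑ p : V × V, ∑ q : V × V, c (E p.1 - E p.2) (E q.1 - E q.2) •
        ((pairComponent U (A a) q)ᴴ * pairComponent U (A a) p) := by
    intro a
    calc _ = ∑ ν₁ ∈ bohrFreqs H, ∑ ν₂ ∈ bohrFreqs H, ∑ p : V × V, ∑ q : V × V,
          (if E q.1 - E q.2 = ν₂ then (if E p.1 - E p.2 = ν₁ then
            c ν₁ ν₂ • ((pairComponent U (A a) q)ᴴ * pairComponent U (A a) p) else 0) else 0) := by
          refine Finset.sum_congr rfl fun ν₁ _ => Finset.sum_congr rfl fun ν₂ _ => ?_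
          rw [hH, bohrComponent_eq_sum hU, bohrComponent_eq_sum hU, Matrix.conjTranspose_sum,
            Finset.mul_sum, Finset.smul_sum]
          refine Finset.sum_congr rfl fun p _ => ?_
          rw [Finset.sum_mul, Finset.smul_sum]
          refine Finset.sum_congr rfl fun q _ => ?_
          split_ifs <;> simp
      _ = ∑ p : V × V, ∑ ν₁ ∈ bohrFreqs H, ∑ q : V × V, ∑ ν₂ ∈ bohrFreqs H,
          (if E q.1 - E q.2 = ν₂ then (if E p.1 - E p.2 = ν₁ then
            c ν₁ ν₂ • ((pairComponent U (A a) q)ᴴ * pairComponent U (A a) p) else 0) else 0) := by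
          rw [Finset.sum_comm (s := Finset.univ)]
          refine Finset.sum_congr rfl fun ν₁ _ => ?_
          rw [Finset.sum_comm]
          exact Finset.sum_congr rfl fun p _ => Finset.sum_comm
      _ = _ := by
          refine Finset.sum_congr rfl fun p _ => ?_
          rw [Finset.sum_comm]
          refine Finset.sum_congr rfl fun q _ => ?_
          simp [hbohr]
  have h2 : coherentTerm β σ H A = ∑ a, ∑ p : V × V, ∑ q : V × V,
      c (E p.1 - E p.2) (E q.1 - E q.2) •
        ((pairComponent U (A a) q)ᴴ * pairComponent U (A a) p) :=
    Finset.sum_congr rfl fun a _ => h1 a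
  rw [h2, Finset.sum_comm]
  refine Finset.sum_eq_zero fun p _ => ?_
  rw [Finset.sum_comm]
  refine Finset.sum_eq_zero fun q _ => ?_
  simp only [conjTranspose_pairComponent_mul hU]
  rw [← Finset.smul_sum]
  split_ifs with h
  · rw [← Finset.sum_smul]
    by_cases h' : p.2 = q.2
    · simp [hc, h, h']
    · have := hA p.1 p.2 q.2 h'
      simp only [correlation] at this
      rw [← h, this]
      simp
  · simp

end CKG

namespace CKG

/-! ### Eigenvalues of real matrices with nonnegative off-diagonal entries -/

section RealMatrix

variable {I : Type*} [Fintype I] [DecidableEq I]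

/-- Gershgorin's bound for the columns of a matrix with nonnegative off-diagonal entries. -/
theorem re_le_of_colSum_le {N : Matrix I I ℝ} {δ : ℝ} (hoff : ∀ i k, i ≠ k → 0 ≤ N i k)
    (hcol : ∀ k, ∑ i, N i k ≤ -δ) {z : ℂ} (hz : (N.map Complex.ofReal).charpoly.IsRoot z) :
    z.re ≤ -δ := by
  by_contra! hlt
  rw [Polynomial.IsRoot, Matrix.eval_charpoly] at hz
  refine det_ne_zero_of_sum_col_lt_diag (fun k => ?_) hz
  have h1 : ∑ i ∈ Finset.univ.erase k, ‖(Matrix.scalar I z - N.map Complex.ofReal) i k‖ =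
      ∑ i, N i k - N k k := by
    rw [← Finset.add_sum_erase _ _ (Finset.mem_univ k), add_sub_cancel_left]
    refine Finset.sum_congr rfl fun i hi => ?_
    have hik := Finset.ne_of_mem_erase hi
    simp [hik, abs_of_nonneg (hoff i k hik)]
  have h2 := Complex.re_le_norm (z - N k k)
  simp only [Complex.sub_re, Complex.ofReal_re] at h2
  rw [h1]
  simp only [Matrix.sub_apply, Matrix.scalar_apply, Matrix.diagonal_apply_eq, Matrix.map_apply]
  linarith [hcol k]

/-- Removing a rank one piece from a matrix with left null vector `τ` changes its spectrum only by
moving one eigenvalue `0`. -/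
theorem charpoly_sub_vecMulVec {N : Matrix I I ℂ} {τ u : I → ℂ} (hτ : τ ᵥ* N = 0) :
    (Polynomial.X + Polynomial.C (τ ⬝ᵥ u)) * N.charpoly =
      Polynomial.X * (N - Matrix.vecMulVec u τ).charpoly := by
  refine Polynomial.eq_of_infinite_eval_eq _ _ (Set.Infinite.mono (s := {0}ᶜ) (fun x hx => ?_)
    (Set.finite_singleton (0 : ℂ)).infinite_compl)
  have hx : x ≠ 0 := hx
  simp only [Set.mem_ofPred_eq, Polynomial.eval_mul, Polynomial.eval_add, Polynomial.eval_X,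
    Polynomial.eval_C, Matrix.eval_charpoly]
  have h1 : τ ᵥ* (Matrix.scalar I x - N) = x • τ := by
    rw [Matrix.vecMul_sub, hτ, sub_zero]
    ext i
    simp [Matrix.vecMul_diagonal, mul_comm]
  -- As `τ` is a left eigenvector of `x - N` with eigenvalue `x ≠ 0`, the perturbation factors out
  -- on the left, and the matrix determinant lemma applies.
  have h2 : Matrix.scalar I x - (N - Matrix.vecMulVec u τ) =
      (1 + Matrix.replicateCol Unit (x⁻¹ • u) * Matrix.replicateRow Unit τ) *
        (Matrix.scalar I x - N) := by
    rw [add_mul, one_mul, ← Matrix.vecMulVec_eq, Matrix.vecMulVec_mul, h1]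
    ext i j
    simp [Matrix.vecMulVec_apply]
    field_simp
    ring
  rw [h2, Matrix.det_mul, Matrix.det_one_add_replicateCol_mul_replicateRow, dotProduct_smul,
    smul_eq_mul]
  field_simp

theorem charpoly_sub_vecMulVec_ofReal {N : Matrix I I ℝ} {τ u : I → ℝ} (hτ : τ ᵥ* N = 0) :
    (Polynomial.X + Polynomial.C ((τ ⬝ᵥ u : ℝ) : ℂ)) * (N.map Complex.ofReal).charpoly =
      Polynomial.X * ((N - Matrix.vecMulVec u τ).map Complex.ofReal).charpoly := by
  have h1 : (fun i => (τ i : ℂ)) ᵥ* N.map Complex.ofReal = 0 := by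
    ext k
    have := congrFun hτ k
    simp only [Matrix.vecMul, dotProduct, Pi.zero_apply, Matrix.map_apply] at this ⊢
    exact_mod_cast this
  convert charpoly_sub_vecMulVec (u := fun i => (u i : ℂ)) h1 using 3
  · simp [dotProduct]
  · ext i j
    simp [Matrix.vecMulVec_apply]

/-- The Rayleigh principle for a matrix satisfying detailed balance with respect to `π`, with the
indicator function of `s` as test function. -/
theorem exists_root_ge_of_detailedBalance {N : Matrix I I ℝ} {π : I → ℝ} {δ : ℝ} {s : Finset I}
    (hπ : ∀ i, 0 < π i) (hN : ∀ i k, N i k * π k = N k i * π i) (hs : s.Nonempty)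
    (hcol : ∀ k ∈ s, -δ ≤ ∑ i ∈ s, N i k) :
    ∃ x : ℝ, -δ ≤ x ∧ (N.map Complex.ofReal).charpoly.IsRoot (x : ℂ) := by
  set W : I → ℝ := fun i => √(π i) with hW
  have hW0 : ∀ i, 0 < W i := fun i => Real.sqrt_pos.2 (hπ i)
  have hW2 : ∀ i, W i * W i = π i := fun i => Real.mul_self_sqrt (hπ i).le
  -- Conjugating by `√π` turns detailed balance into symmetry without changing the spectrum.
  set S : Matrix I I ℝ := Matrix.of fun i k => (W i)⁻¹ * N i k * W k with hS
  have hSH : S.IsHermitian := by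
    ext i k
    simp only [hS, Matrix.conjTranspose_apply, Matrix.of_apply, star_trivial]
    have := hN i k
    rw [← hW2, ← hW2] at this
    have hi := (hW0 i).ne'
    have hk := (hW0 k).ne'
    field_simp
    linarith
  by_contra! hno
  have hchar : N.charpoly = S.charpoly := by
    refine Polynomial.funext fun x => ?_
    rw [Matrix.eval_charpoly, Matrix.eval_charpoly]
    have : Matrix.scalar I x - S = Matrix.diagonal (fun i => (W i)⁻¹) * (Matrix.scalar I x - N) *
        Matrix.diagonal W := by
      ext i k
      simp only [hS, Matrix.mul_diagonal, Matrix.diagonal_mul, Matrix.sub_apply, Matrix.of_apply,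
        Matrix.scalar_apply]
      rcases eq_or_ne i k with rfl | h
      · have := (hW0 i).ne'
        simp
        field_simp
      · simp [h]
    rw [this, Matrix.det_mul, Matrix.det_mul, mul_comm, ← mul_assoc, ← Matrix.det_mul,
      Matrix.diagonal_mul_diagonal]
    simp [fun i => mul_inv_cancel₀ (hW0 i).ne']
  have hTH : (-(δ • (1 : Matrix I I ℝ)) - S).IsHermitian :=
    ((Matrix.isHermitian_one.smul (star_trivial δ)).neg).sub hSH
  -- If all real eigenvalues were below `-δ`, this symmetric matrix would be positive definite; the
  -- test vector `y` contradicts that.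
  have hT : (-(δ • (1 : Matrix I I ℝ)) - S).PosDef := by
    refine hTH.posDef_iff_eigenvalues_pos.2 fun i => ?_
    by_contra! h
    refine hno (-δ - hTH.eigenvalues i) (by linarith) ?_
    have h1 : (-(δ • (1 : Matrix I I ℝ)) - S).charpoly.eval (hTH.eigenvalues i) = 0 := by
      rw [hTH.charpoly_eq, Polynomial.eval_prod]
      exact Finset.prod_eq_zero (Finset.mem_univ i) (by simp)
    have h2 : S.charpoly.IsRoot (-δ - hTH.eigenvalues i) := by
      rw [Matrix.eval_charpoly] at h1
      rw [Polynomial.IsRoot, Matrix.eval_charpoly]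
      have : Matrix.scalar I (-δ - hTH.eigenvalues i) - S =
          -(Matrix.scalar I (hTH.eigenvalues i) - (-(δ • (1 : Matrix I I ℝ)) - S)) := by
        ext i j
        rcases eq_or_ne i j with rfl | hij
        · simp
          ring
        · simp [hij]
      rw [this, Matrix.det_neg, h1, mul_zero]
    rw [← hchar] at h2
    have h3 := h2.map (f := Complex.ofRealHom)
    rw [← Matrix.charpoly_map] at h3
    exact h3
  -- The indicator of `s` in the symmetrised coordinates; its quadratic form is the `π`-weighted sum
  -- of the column sums within `s`.
  set y : I → ℝ := fun i => if i ∈ s then W i else 0 with hy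
  have hy0 : y ≠ 0 := by
    obtain ⟨i, hi⟩ := hs
    intro h
    have := congrFun h i
    simp [hy, hi, (hW0 i).ne'] at this
  have hpos := hT.dotProduct_mulVec_pos hy0
  have hSy : ∀ k ∈ s, ∑ i, y i * S i k * y k = π k * ∑ i ∈ s, N i k := by
    intro k hk
    rw [Finset.mul_sum, ← Finset.sum_subset (Finset.subset_univ s)]
    · refine Finset.sum_congr rfl fun i hi => ?_
      simp only [hy, hi, hk, if_true, hS, Matrix.of_apply, ← hW2]
      have := (hW0 i).ne'
      field_simp
    · intro i _ hi
      simp [hy, hi]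
  have hval : star y ⬝ᵥ (-(δ • (1 : Matrix I I ℝ)) - S) *ᵥ y =
      ∑ k ∈ s, π k * (-δ - ∑ i ∈ s, N i k) := by
    rw [Matrix.sub_mulVec, Matrix.neg_mulVec, Matrix.smul_mulVec, Matrix.one_mulVec, star_trivial,
      dotProduct_sub]
    have h1 : y ⬝ᵥ S *ᵥ y = ∑ k ∈ s, π k * ∑ i ∈ s, N i k := by
      simp only [dotProduct, Matrix.mulVec, Finset.mul_sum, ← mul_assoc]
      rw [Finset.sum_comm, ← Finset.sum_subset (Finset.subset_univ s)]
      · refine Finset.sum_congr rfl fun k hk => ?_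
        rw [hSy k hk, Finset.mul_sum]
      · intro k _ hk
        simp [hy, hk]
    have h2 : y ⬝ᵥ -(δ • y) = ∑ k ∈ s, π k * -δ := by
      rw [dotProduct, ← Finset.sum_subset (Finset.subset_univ s)]
      · refine Finset.sum_congr rfl fun k hk => ?_
        simp only [hy, Pi.neg_apply, Pi.smul_apply, hk, if_true, smul_eq_mul, ← hW2]
        ring
      · intro k _ hk
        simp [hy, hk]
    rw [h1, h2, ← Finset.sum_sub_distrib]
    exact Finset.sum_congr rfl fun k _ => by ring
  rw [hval] at hpos
  exact absurd hpos (not_lt.2 (Finset.sum_nonpos fun k hk =>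
    mul_nonpos_of_nonneg_of_nonpos (hπ k).le (by linarith [hcol k hk])))

/-- If a rank one perturbation of `N` along a left null vector satisfies Gershgorin's bound, then
all eigenvalues of `N` but one copy of `0` obey it. -/
theorem re_le_of_mem_roots_erase {N : Matrix I I ℝ} {τ u : I → ℝ} {δ : ℝ} (hτ : τ ᵥ* N = 0)
    (hc : 0 < τ ⬝ᵥ u) (hoff : ∀ i k, i ≠ k → 0 ≤ (N - Matrix.vecMulVec u τ) i k)
    (hcol : ∀ k, ∑ i, (N - Matrix.vecMulVec u τ) i k ≤ -δ) {z : ℂ}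
    (hz : z ∈ (N.map Complex.ofReal).charpoly.roots.erase 0) : z.re ≤ -δ := by
  have h := congrArg Polynomial.roots (charpoly_sub_vecMulVec_ofReal (u := u) hτ)
  rw [Polynomial.roots_mul (mul_ne_zero (Polynomial.X_add_C_ne_zero _) (Matrix.charpoly_monic _).ne_zero),
    Polynomial.roots_mul (mul_ne_zero Polynomial.X_ne_zero (Matrix.charpoly_monic _).ne_zero),
    Polynomial.roots_X_add_C, Polynomial.roots_X, Multiset.singleton_add,
    Multiset.singleton_add] at h
  have h0 : (0 : ℂ) ≠ -((τ ⬝ᵥ u : ℝ) : ℂ) := by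
    rw [ne_comm, neg_ne_zero, Complex.ofReal_ne_zero]
    exact hc.ne'
  have hmem : (0 : ℂ) ∈ (N.map Complex.ofReal).charpoly.roots := by
    have : (0 : ℂ) ∈ -((τ ⬝ᵥ u : ℝ) : ℂ) ::ₘ (N.map Complex.ofReal).charpoly.roots := by
      rw [h]
      exact Multiset.mem_cons_self _ _
    exact (Multiset.mem_cons.1 this).resolve_left h0
  -- Cancelling one `0` leaves the spectrum of the deflated matrix as `-(τ ⬝ᵥ u)` together with the
  -- remaining eigenvalues of `N`.
  rw [← Multiset.cons_erase hmem, Multiset.cons_swap, Multiset.cons_inj_right] at h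
  refine re_le_of_colSum_le hoff hcol (Polynomial.isRoot_of_mem_roots ?_)
  rw [← h]
  exact Multiset.mem_cons_of_mem hz

/-- An eigenvalue of `N`, other than one copy of `0`, bounded by the Rayleigh principle. -/
theorem exists_mem_roots_erase_norm_le {N : Matrix I I ℝ} {τ u π : I → ℝ} {δ δ' : ℝ} {s : Finset I}
    (hτ : τ ᵥ* N = 0) (hδ : 0 < δ)
    (hoff : ∀ i k, i ≠ k → 0 ≤ (N - Matrix.vecMulVec u τ) i k)
    (hcol : ∀ k, ∑ i, (N - Matrix.vecMulVec u τ) i k ≤ -δ)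
    (hπ : ∀ i, 0 < π i)
    (hN : ∀ i k, (N - Matrix.vecMulVec u τ) i k * π k = (N - Matrix.vecMulVec u τ) k i * π i)
    (hs : s.Nonempty) (hcols : ∀ k ∈ s, -δ' ≤ ∑ i ∈ s, (N - Matrix.vecMulVec u τ) i k)
    (hc : δ' < τ ⬝ᵥ u) :
    ∃ z ∈ (N.map Complex.ofReal).charpoly.roots.erase 0, ‖z‖ ≤ δ' := by
  obtain ⟨x, hx, hroot⟩ := exists_root_ge_of_detailedBalance hπ hN hs hcols
  have hneg := re_le_of_colSum_le hoff hcol hroot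
  rw [Complex.ofReal_re] at hneg
  have h := congrArg (Polynomial.eval (x : ℂ)) (charpoly_sub_vecMulVec_ofReal (u := u) hτ)
  rw [Polynomial.eval_mul, Polynomial.eval_mul, hroot.eq_zero, mul_zero, mul_eq_zero] at h
  refine ⟨x, (Multiset.mem_erase_of_ne ?_).2 ((Polynomial.mem_roots
    (Matrix.charpoly_monic _).ne_zero).2 (h.resolve_left ?_)), ?_⟩
  · rw [Complex.ofReal_ne_zero]
    linarith
  -- The root is not the displaced eigenvalue `-(τ ⬝ᵥ u)`, because `x ≥ -δ' > -(τ ⬝ᵥ u)`.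
  · rw [Polynomial.eval_add, Polynomial.eval_X, Polynomial.eval_C, ← Complex.ofReal_add,
      Complex.ofReal_eq_zero]
    linarith
  · rw [Complex.norm_real, Real.norm_eq_abs, abs_of_nonpos (by linarith)]
    linarith

end RealMatrix

end CKG

namespace CKG

variable {V : Type*} [Fintype V] [DecidableEq V]

/-! ### The Lindbladian in the energy eigenbasis -/

/-- The polarised dissipator `X ↦ K X K'† - (1/2) (K'† K X + X K'† K)`. -/
noncomputable def crossDissipator (K K' : Matrix V V ℂ) : Module.End ℂ (Matrix V V ℂ) :=
  LinearMap.mulLeft ℂ K ∘ₗ LinearMap.mulRight ℂ K'ᴴ -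
    (1 / 2 : ℂ) • (LinearMap.mulLeft ℂ (K'ᴴ * K) + LinearMap.mulRight ℂ (K'ᴴ * K))

theorem crossDissipator_apply (K K' X : Matrix V V ℂ) :
    crossDissipator K K' X = K * X * K'ᴴ - (1 / 2 : ℂ) • (K'ᴴ * K * X + X * (K'ᴴ * K)) := by
  simp [crossDissipator, mul_assoc]

theorem crossDissipator_smul_smul (c d : ℂ) (K K' : Matrix V V ℂ) :
    crossDissipator (c • K) (d • K') = (c * star d) • crossDissipator K K' := by
  ext1 X
  simp only [crossDissipator_apply, LinearMap.smul_apply, Matrix.conjTranspose_smul,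
    Matrix.smul_mul, Matrix.mul_smul, smul_sub, smul_add, smul_smul]
  congr 2 <;> ring_nf

theorem crossDissipator_sum_sum {α : Type*} (s : Finset α) (K K' : α → Matrix V V ℂ) :
    crossDissipator (∑ p ∈ s, K p) (∑ q ∈ s, K' q) =
      ∑ p ∈ s, ∑ q ∈ s, crossDissipator (K p) (K' q) := by
  have h1 : ∀ K' : Matrix V V ℂ, crossDissipator (∑ p ∈ s, K p) K' =
      ∑ p ∈ s, crossDissipator (K p) K' := by
    intro K'
    ext1 X
    simp only [crossDissipator_apply, LinearMap.sum_apply, Finset.sum_mul, Finset.mul_sum,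
      Finset.smul_sum, Finset.sum_sub_distrib, Finset.sum_add_distrib, smul_add]
  have h2 : ∀ K : Matrix V V ℂ, crossDissipator K (∑ q ∈ s, K' q) =
      ∑ q ∈ s, crossDissipator K (K' q) := by
    intro K
    ext1 X
    simp only [crossDissipator_apply, LinearMap.sum_apply, Finset.sum_mul, Finset.mul_sum,
      Finset.smul_sum, Finset.sum_sub_distrib, Finset.sum_add_distrib, smul_add,
      Matrix.conjTranspose_sum]
  rw [h1]
  exact Finset.sum_congr rfl fun p _ => h2 _

/-! ### Integration over `ω` and the matrix of the Lindbladian -/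

theorem superIntegral_sum_smul {α : Type*} (s : Finset α) (c : α → ℝ → ℝ)
    (hc : ∀ p ∈ s, Integrable (c p)) (G : α → Module.End ℂ (Matrix V V ℂ)) :
    superIntegral (fun ω => ∑ p ∈ s, (c p ω : ℂ) • G p) =
      ∑ p ∈ s, ((∫ ω, c p ω : ℝ) : ℂ) • G p := by
  refine (Matrix.stdBasis ℂ V V).ext fun b => ?_
  rw [superIntegral, Module.Basis.constr_basis]
  ext i j
  simp only [Matrix.of_apply, LinearMap.sum_apply, LinearMap.smul_apply, Matrix.sum_apply,
    Matrix.smul_apply, smul_eq_mul]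
  rw [integral_finsetSum _ fun p hp => (hc p hp).ofReal.mul_const _]
  refine Finset.sum_congr rfl fun p _ => ?_
  rw [integral_mul_const, integral_complex_ofReal, Matrix.stdBasis_eq_single]

theorem superIntegral_dissipator {β σ : ℝ} (hβ : 0 ≤ β) (hσ : 0 < σ) {U : Matrix V V ℂ}
    (hU : U ∈ unitary (Matrix V V ℂ)) (E : V → ℝ) (A : Matrix V V ℂ) :
    (superIntegral fun ω => (filter β σ ω : ℂ) • dissipator
      (operatorFT σ (U * Matrix.diagonal (fun k => (E k : ℂ)) * Uᴴ) A ω)) =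
    ∑ r : (V × V) × (V × V), (theta β σ (E r.1.1 - E r.1.2) (E r.2.1 - E r.2.2) : ℂ) •
      crossDissipator (pairComponent U A r.1) (pairComponent U A r.2) := by
  have h : ∀ ω, (filter β σ ω : ℂ) • dissipator
      (operatorFT σ (U * Matrix.diagonal (fun k => (E k : ℂ)) * Uᴴ) A ω) =
      ∑ r : (V × V) × (V × V), ((windowHat σ (ω - (E r.1.1 - E r.1.2)) *
        windowHat σ (ω - (E r.2.1 - E r.2.2)) * filter β σ ω : ℝ) : ℂ) •
          crossDissipator (pairComponent U A r.1) (pairComponent U A r.2) := by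
    intro ω
    change (filter β σ ω : ℂ) • crossDissipator _ _ = _
    rw [operatorFT_eq_sum hσ hU, crossDissipator_sum_sum, Finset.smul_sum,
      Fintype.sum_prod_type (α₁ := V × V) (α₂ := V × V)]
    refine Finset.sum_congr rfl fun p _ => ?_
    rw [Finset.smul_sum]
    refine Finset.sum_congr rfl fun q _ => ?_
    rw [crossDissipator_smul_smul, smul_smul]
    congr 1
    push_cast
    simp only [RCLike.star_def, Complex.conj_ofReal]
    ring
  simp_rw [h]
  exact superIntegral_sum_smul _ _ (fun r _ => integrable_theta hβ hσ _ _) _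

theorem pairComponent_eq_smul (U A : Matrix V V ℂ) (p : V × V) :
    pairComponent U A p = (Uᴴ * A * U) p.1 p.2 • (U * Matrix.single p.1 p.2 1 * Uᴴ) := by
  rw [pairComponent, ← Matrix.smul_mul, ← Matrix.mul_smul, Matrix.smul_single, smul_eq_mul, mul_one]

theorem lindbladian_eq_sum {ι : Type*} [Fintype ι] {β σ : ℝ} (hβ : 0 ≤ β) (hσ : 0 < σ)
    {U : Matrix V V ℂ} (hU : U ∈ unitary (Matrix V V ℂ)) (E : V → ℝ) (A : ι → Matrix V V ℂ)
    (hA : ∀ k l l', l ≠ l' → correlation U A (k, l) (k, l') = 0) :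
    lindbladian β σ (U * Matrix.diagonal (fun k => (E k : ℂ)) * Uᴴ) A =
      ∑ r : (V × V) × (V × V),
        (theta β σ (E r.1.1 - E r.1.2) (E r.2.1 - E r.2.2) * correlation U A r.1 r.2 : ℂ) •
          crossDissipator (U * Matrix.single r.1.1 r.1.2 1 * Uᴴ)
            (U * Matrix.single r.2.1 r.2.2 1 * Uᴴ) := by
  have h0 : commutator (0 : Matrix V V ℂ) = 0 := by
    ext1 X
    simp [commutator]
  rw [lindbladian, coherentTerm_eq_zero hU E A β σ hA, h0, smul_zero, zero_add]
  simp_rw [superIntegral_dissipator hβ hσ hU]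
  rw [Finset.sum_comm]
  refine Finset.sum_congr rfl fun r _ => ?_
  simp only [pairComponent_eq_smul, crossDissipator_smul_smul, smul_smul]
  rw [← Finset.sum_smul, correlation, Finset.mul_sum]

/-- Conjugation by a unitary, as a linear equivalence. -/
noncomputable def conjEquiv (U : Matrix V V ℂ) (hU : U ∈ unitary (Matrix V V ℂ)) :
    Matrix V V ℂ ≃ₗ[ℂ] Matrix V V ℂ :=
  LinearEquiv.ofLinearMap
    (LinearMap.mulLeft ℂ U ∘ₗ LinearMap.mulRight ℂ Uᴴ)
    (LinearMap.mulLeft ℂ Uᴴ ∘ₗ LinearMap.mulRight ℂ U)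
    (by
      have h : U * Uᴴ = 1 := (Unitary.mem_iff.1 hU).2
      ext1 X
      simp only [LinearMap.comp_apply, LinearMap.mulLeft_apply, LinearMap.mulRight_apply,
        LinearMap.id_apply]
      calc _ = (U * Uᴴ) * X * (U * Uᴴ) := by simp only [mul_assoc]
        _ = X := by rw [h, one_mul, mul_one])
    (by
      have h : Uᴴ * U = 1 := (Unitary.mem_iff.1 hU).1
      ext1 X
      simp only [LinearMap.comp_apply, LinearMap.mulLeft_apply, LinearMap.mulRight_apply,
        LinearMap.id_apply]
      calc _ = (Uᴴ * U) * X * (Uᴴ * U) := by simp only [mul_assoc]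
        _ = X := by rw [h, one_mul, mul_one])

theorem conjEquiv_conj_crossDissipator (U : Matrix V V ℂ) (hU : U ∈ unitary (Matrix V V ℂ))
    (K K' : Matrix V V ℂ) :
    (conjEquiv U hU).conj (crossDissipator K K') =
      crossDissipator (U * K * Uᴴ) (U * K' * Uᴴ) := by
  have h : Uᴴ * U = 1 := (Unitary.mem_iff.1 hU).1
  have h' : U * Uᴴ = 1 := (Unitary.mem_iff.1 hU).2
  have h1 : ∀ X, Uᴴ * (U * X) = X := fun X => by rw [← mul_assoc, h, one_mul]
  have h2 : ∀ X, U * (Uᴴ * X) = X := fun X => by rw [← mul_assoc, h', one_mul]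
  ext1 X
  rw [LinearEquiv.conj_apply_apply, crossDissipator_apply, crossDissipator_apply]
  simp only [conjEquiv, LinearEquiv.coe_ofLinearMap, LinearEquiv.symm_ofLinearMap,
    LinearMap.comp_apply, LinearMap.mulLeft_apply, LinearMap.mulRight_apply,
    Matrix.conjTranspose_mul, Matrix.conjTranspose_conjTranspose, Matrix.sub_mul, Matrix.mul_sub,
    Matrix.add_mul, Matrix.mul_add, Matrix.smul_mul, Matrix.mul_smul, mul_assoc, h1, h2, h', mul_one]

theorem single_mul_single_eq (i j k l : V) :
    Matrix.single i j (1 : ℂ) * Matrix.single k l 1 = if j = k then Matrix.single i l 1 else 0 := by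
  split_ifs with h
  · rw [h, Matrix.single_mul_single_same, mul_one]
  · rw [Matrix.single_mul_single_of_ne _ _ _ _ h]

theorem crossDissipator_single_apply (k l k' l' p q i j : V) :
    crossDissipator (Matrix.single k l 1) (Matrix.single k' l' 1) (Matrix.single p q 1) i j =
      (if l' = q then if k' = j then if l = p then if k = i then 1 else 0 else 0 else 0 else 0) -
        (1 / 2 : ℂ) *
          ((if l' = i then if k' = k then if l = p then if q = j then 1 else 0 else 0 else 0 else 0)
            + (if l' = q then if k' = k then if l = j then if p = i then 1 else 0 else 0 else 0
              else 0)) := by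
  rw [crossDissipator_apply, Matrix.conjTranspose_single, star_one, single_mul_single_eq k l p q,
    single_mul_single_eq l' k' k l]
  have h1 : (if l = p then Matrix.single k q (1 : ℂ) else 0) * Matrix.single l' k' 1 =
      if l' = q then if l = p then Matrix.single k k' 1 else 0 else 0 := by
    split_ifs <;> simp_all [eq_comm]
  have h2 : (if k' = k then Matrix.single l' l (1 : ℂ) else 0) * Matrix.single p q 1 =
      if k' = k then if l = p then Matrix.single l' q 1 else 0 else 0 := by
    split_ifs <;> simp_all [single_mul_single_eq]
  have h3 : Matrix.single p q (1 : ℂ) * (if k' = k then Matrix.single l' l (1 : ℂ) else 0) =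
      if k' = k then if l' = q then Matrix.single p l 1 else 0 else 0 := by
    split_ifs <;> simp_all [single_mul_single_eq, eq_comm]
  rw [h1, h2, h3]
  simp only [Matrix.sub_apply, Matrix.smul_apply, Matrix.add_apply, smul_eq_mul]
  congr 1
  · split_ifs <;> simp_all
  · congr 2
    · split_ifs <;> simp_all
    · split_ifs <;> simp_all

/-- After conjugation to the eigenbasis, the jump part directly gives the first term. The
anticommutator could mix matrix units only through correlations of `(k, l)` with `(k, l')`, `l ≠
l'`, so it is diagonal. -/
theorem charpoly_lindbladian {ι : Type*} [Fintype ι] {β σ : ℝ} (hβ : 0 ≤ β) (hσ : 0 < σ)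
    {U : Matrix V V ℂ} (hU : U ∈ unitary (Matrix V V ℂ)) (E : V → ℝ) (A : ι → Matrix V V ℂ)
    (hA : ∀ k l l', l ≠ l' → correlation U A (k, l) (k, l') = 0) :
    (lindbladian β σ (U * Matrix.diagonal (fun k => (E k : ℂ)) * Uᴴ) A).charpoly =
      (Matrix.of fun x y : V × V =>
        theta β σ (E x.1 - E y.1) (E x.2 - E y.2) * correlation U A (x.1, y.1) (x.2, y.2) -
          if x = y then 1 / 2 * ∑ k, (theta β σ (E k - E y.1) (E k - E y.1) *
            correlation U A (k, y.1) (k, y.1) + theta β σ (E k - E y.2) (E k - E y.2) *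
            correlation U A (k, y.2) (k, y.2)) else 0 : Matrix (V × V) (V × V) ℂ).charpoly := by
  set L₀ : Module.End ℂ (Matrix V V ℂ) := ∑ r : (V × V) × (V × V),
    (theta β σ (E r.1.1 - E r.1.2) (E r.2.1 - E r.2.2) * correlation U A r.1 r.2 : ℂ) •
      crossDissipator (Matrix.single r.1.1 r.1.2 1) (Matrix.single r.2.1 r.2.2 1) with hL₀
  have h1 : lindbladian β σ (U * Matrix.diagonal (fun k => (E k : ℂ)) * Uᴴ) A =
      (conjEquiv U hU).conj L₀ := by
    rw [lindbladian_eq_sum hβ hσ hU E A hA, hL₀, map_sum]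
    refine Finset.sum_congr rfl fun r _ => ?_
    rw [map_smul, conjEquiv_conj_crossDissipator]
  rw [h1, LinearEquiv.charpoly_conj, ← LinearMap.charpoly_toMatrix L₀ (Matrix.stdBasis ℂ V V)]
  congr 1
  ext ⟨i, j⟩ ⟨p, q⟩
  have h2 : LinearMap.toMatrix (Matrix.stdBasis ℂ V V) (Matrix.stdBasis ℂ V V) L₀ (i, j) (p, q) =
      L₀ (Matrix.single p q 1) i j := by
    rw [LinearMap.toMatrix_apply, Matrix.stdBasis_eq_single]
    rfl
  rw [h2, hL₀, LinearMap.sum_apply, Matrix.sum_apply]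
  simp only [LinearMap.smul_apply, Matrix.smul_apply, crossDissipator_single_apply, smul_eq_mul,
    mul_sub, Finset.sum_sub_distrib, Matrix.of_apply]
  congr 1
  · simp [Fintype.sum_prod_type]
  · simp only [mul_left_comm _ (1 / 2 : ℂ), ← Finset.mul_sum, mul_add, Finset.sum_add_distrib]
    simp only [Fintype.sum_prod_type, mul_ite, mul_one, mul_zero, Finset.sum_ite_eq',
      Finset.mem_univ, if_true, Prod.mk.injEq]
    by_cases hip : i = p
    · by_cases hjq : j = q
      · simp [hip, hjq]
      · have := fun k => hA k j q hjq
        simp [hip, hjq, Ne.symm hjq, this]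
    · have := fun k => hA k p i (Ne.symm hip)
      simp [hip, Ne.symm hip, this]

end CKG

namespace CKG

/-! ### The rate matrix of a translation covariant Lindbladian -/

section RateMatrix

variable {G : Type*} [AddCommGroup G] [Fintype G] [DecidableEq G]

/-- The matrix of the Lindbladian in the basis `|k⟩⟨l|` when the jump operators are translation
covariant with strength `κ`. -/
noncomputable def rateMatrix (β σ κ : ℝ) (E : G → ℝ) : Matrix (G × G) (G × G) ℝ :=
  Matrix.of fun x y =>
    (if x.1 - y.1 = x.2 - y.2 then κ * theta β σ (E x.1 - E y.1) (E x.2 - E y.2) else 0) -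
      if x = y then κ / 2 * ∑ k, (theta β σ (E k - E y.1) (E k - E y.1) +
        theta β σ (E k - E y.2) (E k - E y.2)) else 0

/-- The trace functional in the basis `|k⟩⟨l|`. -/
def traceVec (G : Type*) [DecidableEq G] (x : G × G) : ℝ := if x.1 = x.2 then 1 else 0

/-- A multiple of the Gibbs state in the basis `|k⟩⟨l|`. -/
noncomputable def gibbsVec (β c : ℝ) (E : G → ℝ) (x : G × G) : ℝ :=
  if x.1 = x.2 then c * Real.exp (-β * E x.1) else 0

theorem sum_sector (f : G × G → ℝ) (y : G × G) :
    ∑ x : G × G, (if x.1 - y.1 = x.2 - y.2 then f x else 0) = ∑ s, f (y.1 + s, y.2 + s) := by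
  rw [Fintype.sum_prod_type, ← Equiv.sum_comp (Equiv.addLeft y.1)]
  refine Finset.sum_congr rfl fun s _ => ?_
  rw [Finset.sum_eq_single (y.2 + s)]
  · simp
  · intro b _ hb
    rw [if_neg]
    intro h
    apply hb
    simp only [Equiv.coe_addLeft, add_sub_cancel_left] at h
    rw [h]
    abel
  · simp

/-- Within a sector the targets are the common translates of `y`. Reindexing the loss terms by the
same translation pairs them with the gain terms into Cauchy–Schwarz defects. -/
theorem rateMatrix_colSum (β σ κ : ℝ) (E : G → ℝ) (y : G × G) :
    ∑ x, rateMatrix β σ κ E x y = -(κ / 2) * ∑ s,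
      (theta β σ (E (y.1 + s) - E y.1) (E (y.1 + s) - E y.1) +
        theta β σ (E (y.2 + s) - E y.2) (E (y.2 + s) - E y.2) -
          2 * theta β σ (E (y.1 + s) - E y.1) (E (y.2 + s) - E y.2)) := by
  simp only [rateMatrix, Matrix.of_apply, Finset.sum_sub_distrib, Finset.sum_add_distrib]
  rw [sum_sector (fun x => κ * theta β σ (E x.1 - E y.1) (E x.2 - E y.2)), Finset.sum_ite_eq',
    if_pos (Finset.mem_univ _),
    ← Equiv.sum_comp (Equiv.addLeft y.1) fun k => theta β σ (E k - E y.1) (E k - E y.1),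
    ← Equiv.sum_comp (Equiv.addLeft y.2) fun k => theta β σ (E k - E y.2) (E k - E y.2),
    ← Finset.mul_sum, ← Finset.mul_sum]
  simp only [Equiv.coe_addLeft]
  ring

theorem rateMatrix_eq_zero (β σ κ : ℝ) (E : G → ℝ) {x y : G × G} (h : x.1 - y.1 ≠ x.2 - y.2) :
    rateMatrix β σ κ E x y = 0 := by
  have : x ≠ y := by
    rintro rfl
    simp at h
  simp [rateMatrix, h, this]

/-- Trace preservation: on the diagonal sector the two frequencies coincide and every defect is
zero, while the other sectors never meet the diagonal. -/
theorem traceVec_vecMul_rateMatrix (β σ κ : ℝ) (E : G → ℝ) :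
    traceVec G ᵥ* rateMatrix β σ κ E = 0 := by
  ext y
  rw [Matrix.vecMul, dotProduct, Pi.zero_apply]
  by_cases hy : y.1 = y.2
  · rw [← neg_zero, ← mul_zero (κ / 2), ← neg_mul]
    convert rateMatrix_colSum β σ κ E y using 1
    · refine Finset.sum_congr rfl fun x _ => ?_
      by_cases hx : x.1 = x.2
      · simp [traceVec, hx]
      · rw [rateMatrix_eq_zero, mul_zero]
        rw [hy]
        exact fun h => hx (sub_left_injective h)
    · rw [hy]
      congr 1
      rw [eq_comm]
      exact Finset.sum_eq_zero fun s _ => by ring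
  · refine Finset.sum_eq_zero fun x _ => ?_
    by_cases hx : x.1 = x.2
    · rw [rateMatrix_eq_zero, mul_zero]
      rw [hx]
      exact fun h => hy (sub_right_injective h)
    · simp [traceVec, hx]

theorem traceVec_dotProduct_gibbsVec (β c : ℝ) (E : G → ℝ) :
    traceVec G ⬝ᵥ gibbsVec β c E = ∑ k, c * Real.exp (-β * E k) := by
  simp [dotProduct, traceVec, gibbsVec, Fintype.sum_prod_type]

theorem le_traceVec_dotProduct_gibbsVec {β c R : ℝ} (hβ : 0 ≤ β) (hc : 0 ≤ c) {E : G → ℝ}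
    (hE : ∀ k, |E k| ≤ R) :
    Fintype.card G * (c * Real.exp (-β * R)) ≤ traceVec G ⬝ᵥ gibbsVec β c E := by
  rw [traceVec_dotProduct_gibbsVec, ← nsmul_eq_mul, Fintype.card]
  refine Finset.card_nsmul_le_sum _ _ _ fun k _ => ?_
  have := (abs_le.1 (hE k)).2
  exact mul_le_mul_of_nonneg_left (Real.exp_le_exp.2 (by nlinarith)) hc

/-! ### Deflation by the Gibbs vector -/

/-- Only transitions between populations are altered; their rates are at least `κ * c * e^{βR}`,
which dominates the subtracted Gibbs weight since `-E ≤ R`. -/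
theorem deflated_offDiag_nonneg {β σ κ c R : ℝ} (hβ : 0 ≤ β) (hσ : 0 < σ) (hκ : 0 ≤ κ)
    (hc : 0 ≤ c) {E : G → ℝ}
    (hE : ∀ k, |E k| ≤ R) (hθ : ∀ ν, |ν| ≤ 2 * R → c * Real.exp (β * R) ≤ theta β σ ν ν)
    {x y : G × G} (hxy : x ≠ y) :
    0 ≤ (rateMatrix β σ κ E - Matrix.vecMulVec (gibbsVec β (κ * c) E) (traceVec G)) x y := by
  rw [Matrix.sub_apply, Matrix.vecMulVec_apply, rateMatrix, Matrix.of_apply, if_neg hxy, sub_zero]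
  have hθ0 : 0 ≤ κ * theta β σ (E x.1 - E y.1) (E x.2 - E y.2) :=
    mul_nonneg hκ (theta_nonneg hσ _ _)
  by_cases hy : y.1 = y.2
  · by_cases hx : x.1 = x.2
    · simp only [gibbsVec, traceVec, hx, hy, if_true, mul_one]
      obtain ⟨h1, h2⟩ := abs_le.1 (hE x.2)
      obtain ⟨h3, h4⟩ := abs_le.1 (hE y.2)
      have h5 := hθ (E x.2 - E y.2) (abs_le.2 ⟨by linarith, by linarith⟩)
      have h6 : Real.exp (-β * E x.2) ≤ Real.exp (β * R) := Real.exp_le_exp.2 (by nlinarith)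
      rw [mul_assoc, sub_nonneg]
      refine mul_le_mul_of_nonneg_left (le_trans ?_ h5) hκ
      gcongr
    · simp only [gibbsVec, hx, if_false, zero_mul, sub_zero]
      split_ifs <;> simp [hθ0]
  · simp only [traceVec, hy, if_false, mul_zero, sub_zero]
    split_ifs <;> simp [hθ0]

theorem deflated_colSum (β σ κ c : ℝ) (E : G → ℝ) (y : G × G) :
    ∑ x, (rateMatrix β σ κ E - Matrix.vecMulVec (gibbsVec β c E) (traceVec G)) x y =
      ∑ x, rateMatrix β σ κ E x y -
        if y.1 = y.2 then traceVec G ⬝ᵥ gibbsVec β c E else 0 := by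
  simp only [Matrix.sub_apply, Finset.sum_sub_distrib, Matrix.vecMulVec_apply]
  congr 1
  rw [← Finset.sum_mul, traceVec, mul_ite, mul_one, mul_zero, dotProduct]
  congr 1
  refine Finset.sum_congr rfl fun x _ => ?_
  by_cases hx : x.1 = x.2 <;> simp [traceVec, gibbsVec, hx]

/-- The two entries of the minimum are the two mechanisms: decoherence off the diagonal sector, and
on it the subtracted Gibbs mass, a Doeblin-type bound. -/
theorem deflated_colSum_le {β σ κ c c' D R : ℝ} (hβ : 0 ≤ β) (hκ : 0 ≤ κ)
    (hc : 0 ≤ c) (hc' : 0 ≤ c') {E : G → ℝ} (hE : ∀ k, |E k| ≤ R)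
    (hθ : ∀ a b, |a| ≤ 2 * R → |b| ≤ 2 * R →
      c' * (a - b) ^ 2 ≤ theta β σ a a + theta β σ b b - 2 * theta β σ a b)
    (hD : ∀ k l, k ≠ l → D ≤ ∑ s, ((E (k + s) - E k) - (E (l + s) - E l)) ^ 2) (y : G × G) :
    ∑ x, (rateMatrix β σ κ E - Matrix.vecMulVec (gibbsVec β (κ * c) E) (traceVec G)) x y ≤
      -min (κ / 2 * (c' * D)) (κ * (Fintype.card G * (c * Real.exp (-β * R)))) := by
  rw [deflated_colSum, rateMatrix_colSum]
  have hE2 : ∀ k l, |E k - E l| ≤ 2 * R := fun k l => by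
    obtain ⟨h1, h2⟩ := abs_le.1 (hE k)
    obtain ⟨h3, h4⟩ := abs_le.1 (hE l)
    exact abs_le.2 ⟨by linarith, by linarith⟩
  have hdef : c' * ∑ s, ((E (y.1 + s) - E y.1) - (E (y.2 + s) - E y.2)) ^ 2 ≤ ∑ s,
      (theta β σ (E (y.1 + s) - E y.1) (E (y.1 + s) - E y.1) +
        theta β σ (E (y.2 + s) - E y.2) (E (y.2 + s) - E y.2) -
          2 * theta β σ (E (y.1 + s) - E y.1) (E (y.2 + s) - E y.2)) := by
    rw [Finset.mul_sum]
    exact Finset.sum_le_sum fun s _ => hθ _ _ (hE2 _ _) (hE2 _ _)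
  have h0 : 0 ≤ c' * ∑ s, ((E (y.1 + s) - E y.1) - (E (y.2 + s) - E y.2)) ^ 2 :=
    mul_nonneg hc' (Finset.sum_nonneg fun s _ => sq_nonneg _)
  have hdef2 := mul_le_mul_of_nonneg_left hdef (div_nonneg hκ zero_le_two)
  by_cases hy : y.1 = y.2
  · rw [if_pos hy]
    have h1 := le_traceVec_dotProduct_gibbsVec hβ (mul_nonneg hκ hc) hE
    have h2 := min_le_right (κ / 2 * (c' * D)) (κ * (Fintype.card G * (c * Real.exp (-β * R))))
    have h3 := mul_nonneg (div_nonneg hκ zero_le_two) h0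
    linarith
  · rw [if_neg hy]
    have h1 := mul_le_mul_of_nonneg_left (mul_le_mul_of_nonneg_left (hD _ _ hy) hc')
      (div_nonneg hκ zero_le_two)
    have h2 := min_le_left (κ / 2 * (c' * D)) (κ * (Fintype.card G * (c * Real.exp (-β * R))))
    linarith

/-- The weight of `|k⟩⟨l|` is the geometric mean of the Gibbs weights of `k` and `l`. On the
diagonal it is the Gibbs weight itself, so the rank one correction satisfies the same relation. -/
theorem deflated_detailedBalance {β σ : ℝ} (hσ : 0 < σ) (κ c : ℝ) (E : G → ℝ) (x y : G × G) :
    (rateMatrix β σ κ E - Matrix.vecMulVec (gibbsVec β c E) (traceVec G)) x y *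
        Real.exp (-β * (E y.1 + E y.2) / 2) =
      (rateMatrix β σ κ E - Matrix.vecMulVec (gibbsVec β c E) (traceVec G)) y x *
        Real.exp (-β * (E x.1 + E x.2) / 2) := by
  rcases eq_or_ne x y with rfl | hxy
  · rfl
  have h1 : theta β σ (E x.1 - E y.1) (E x.2 - E y.2) * Real.exp (-β * (E y.1 + E y.2) / 2) =
      theta β σ (E y.1 - E x.1) (E y.2 - E x.2) * Real.exp (-β * (E x.1 + E x.2) / 2) := by
    rw [← neg_sub (E x.1), ← neg_sub (E x.2), theta_neg hσ, mul_right_comm, ← Real.exp_add,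
      mul_comm]
    congr 2
    ring
  have h2 : gibbsVec β c E x * traceVec G y * Real.exp (-β * (E y.1 + E y.2) / 2) =
      gibbsVec β c E y * traceVec G x * Real.exp (-β * (E x.1 + E x.2) / 2) := by
    by_cases hx : x.1 = x.2 <;> by_cases hy : y.1 = y.2 <;> simp only [gibbsVec, traceVec, hx, hy,
      if_true, if_false, mul_one, mul_zero, zero_mul]
    rw [mul_assoc, mul_assoc, ← Real.exp_add, ← Real.exp_add]
    congr 2
    ring
  simp only [Matrix.sub_apply, Matrix.vecMulVec_apply, sub_mul, h2]
  congr 1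
  simp only [rateMatrix, Matrix.of_apply, if_neg hxy, if_neg hxy.symm, sub_zero]
  have h3 : x.1 - y.1 = x.2 - y.2 ↔ y.1 - x.1 = y.2 - x.2 := by
    rw [← neg_inj, neg_sub, neg_sub]
  by_cases h : x.1 - y.1 = x.2 - y.2
  · rw [if_pos h, if_pos (h3.1 h), mul_assoc, h1, mul_assoc]
  · rw [if_neg h, if_neg (fun h' => h (h3.2 h')), zero_mul, zero_mul]

/-- The sector `k - l = q` is invariant and misses the diagonal, so its column sums are full column
sums of the undeflated matrix. -/
theorem deflated_sectorSum_ge {β σ κ c D : ℝ} (hβ : 0 ≤ β) (hσ : 0 < σ) (hκ : 0 ≤ κ) {E : G → ℝ}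
    {q : G} (hq : q ≠ 0)
    (hD : ∀ k, ∑ s, ((E (k + q + s) - E (k + q)) - (E (k + s) - E k)) ^ 2 ≤ D) :
    ∀ y ∈ Finset.univ.filter (fun x : G × G => x.1 = x.2 + q),
      -(κ / 2 * (1 / (4 * σ ^ 2) * D)) ≤
        ∑ x ∈ Finset.univ.filter (fun x : G × G => x.1 = x.2 + q),
          (rateMatrix β σ κ E - Matrix.vecMulVec (gibbsVec β c E) (traceVec G)) x y := by
  intro y hy
  rw [Finset.mem_filter] at hy
  have hy' : y.1 ≠ y.2 := by
    rw [hy.2]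
    simpa using hq
  have h1 : ∑ x ∈ Finset.univ.filter (fun x : G × G => x.1 = x.2 + q),
      (rateMatrix β σ κ E - Matrix.vecMulVec (gibbsVec β c E) (traceVec G)) x y =
      ∑ x, rateMatrix β σ κ E x y := by
    rw [Finset.sum_filter]
    refine Finset.sum_congr rfl fun x _ => ?_
    split_ifs with hx
    · simp [Matrix.vecMulVec_apply, traceVec, hy']
    · rw [rateMatrix_eq_zero]
      intro h
      apply hx
      rw [hy.2, sub_eq_sub_iff_add_eq_add] at h
      apply add_right_cancel (b := y.2)
      rw [h]
      abel
  rw [h1, rateMatrix_colSum, neg_mul, neg_le_neg_iff]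
  refine mul_le_mul_of_nonneg_left ?_ (div_nonneg hκ zero_le_two)
  refine le_trans (Finset.sum_le_sum fun s _ => theta_defect_le hβ hσ _ _) ?_
  rw [← Finset.mul_sum, hy.2]
  exact mul_le_mul_of_nonneg_left (hD y.2) (by positivity)

end RateMatrix

end CKG

namespace CKG

/-! ### Fourier analysis on the cycle -/

section Cycle

variable (m : ℕ)

/-- The standard additive character of `ℤ/(m+3)`, on vertices of the cycle. -/
noncomputable def cycleChar (k : Fin (m + 3)) : ℂ := ZMod.stdAddChar (ZMod.finEquiv (m + 3) k)

/-- The discrete Fourier matrix. -/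
noncomputable def fourierMatrix : Matrix (Fin (m + 3)) (Fin (m + 3)) ℂ :=
  Matrix.of fun j k => ((1 / √((m + 3 : ℕ) : ℝ) : ℝ) : ℂ) *
    ZMod.stdAddChar (ZMod.finEquiv (m + 3) j * ZMod.finEquiv (m + 3) k)

/-- The eigenvalues `2 cos (2πk/n)` of the cycle. -/
noncomputable def cycleEnergy (k : Fin (m + 3)) : ℝ := 2 * (cycleChar m k).re

theorem sum_stdAddChar_mul (b : ZMod (m + 3)) :
    ∑ j : Fin (m + 3), ZMod.stdAddChar (ZMod.finEquiv (m + 3) j * b) =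
      if b = 0 then ((m + 3 : ℕ) : ℂ) else 0 := by
  have h := (ZMod.finEquiv (m + 3)).toEquiv.sum_comp fun j => ZMod.stdAddChar (j * b)
  rw [RingEquiv.toEquiv_eq_coe] at h
  refine h.trans ?_
  rw [AddChar.sum_mulShift b (ZMod.isPrimitive_stdAddChar (m + 3)), ZMod.card]
  split_ifs <;> simp

theorem fourierMatrix_mem_unitary :
    fourierMatrix m ∈ unitary (Matrix (Fin (m + 3)) (Fin (m + 3)) ℂ) := by
  have h : (fourierMatrix m)ᴴ * fourierMatrix m = 1 := by
    ext k l
    rw [Matrix.mul_apply]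
    have h1 : ∀ j, (fourierMatrix m)ᴴ k j * fourierMatrix m j l = ((m + 3 : ℕ) : ℂ)⁻¹ *
        ZMod.stdAddChar (ZMod.finEquiv (m + 3) j *
          (ZMod.finEquiv (m + 3) l - ZMod.finEquiv (m + 3) k)) := by
      intro j
      rw [Matrix.conjTranspose_apply, fourierMatrix, Matrix.of_apply, Matrix.of_apply, star_mul',
        mul_mul_mul_comm, mul_sub, sub_eq_neg_add, AddChar.map_add_eq_mul, AddChar.map_neg_eq_conj]
      congr 1
      rw [RCLike.star_def, Complex.conj_ofReal, ← Complex.ofReal_mul, one_div, ← mul_inv,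
        Real.mul_self_sqrt (by positivity)]
      push_cast
      rfl
    simp_rw [h1]
    rw [← Finset.mul_sum, sum_stdAddChar_mul, Matrix.one_apply]
    have h2 : ZMod.finEquiv (m + 3) l - ZMod.finEquiv (m + 3) k = 0 ↔ k = l := by
      rw [sub_eq_zero, (ZMod.finEquiv (m + 3)).injective.eq_iff, eq_comm]
    simp only [h2]
    have h3 : ((m + 3 : ℕ) : ℂ) ≠ 0 := Nat.cast_ne_zero.2 (Nat.succ_ne_zero _)
    rw [mul_ite, mul_zero, inv_mul_cancel₀ h3]
  exact Unitary.mem_iff.2 ⟨h, mul_eq_one_comm.1 h⟩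

/-- This is where `n ≥ 3` enters: the two neighbours of a vertex are distinct, and the squared
character is nontrivial. -/
theorem two_ne_zero_zmod : (2 : ZMod (m + 3)) ≠ 0 := by
  have h : ((2 : ℕ) : ZMod (m + 3)) ≠ 0 := by
    rw [Ne, ZMod.natCast_eq_zero_iff]
    exact fun h => absurd (Nat.le_of_dvd two_pos h) (by omega)
  exact_mod_cast h

theorem cycleHamiltonian_mul_fourierMatrix :
    cycleHamiltonian (m + 3) * fourierMatrix m =
      fourierMatrix m * Matrix.diagonal (fun k => (cycleEnergy m k : ℂ)) := by
  ext j k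
  rw [cycleHamiltonian, SimpleGraph.adjMatrix_mul_apply, Matrix.mul_diagonal]
  have hne : j - 1 ≠ j + 1 := by
    intro h
    have h1 := congrArg (ZMod.finEquiv (m + 3)) h
    rw [map_sub, map_add, map_one, sub_eq_iff_eq_add, add_assoc, left_eq_add, one_add_one_eq_two]
      at h1
    exact two_ne_zero_zmod m h1
  have hset : (SimpleGraph.cycleGraph (m + 3)).neighborFinset j = {j - 1, j + 1} := by
    convert SimpleGraph.cycleGraph_neighborFinset (n := m + 1) (v := j)
  rw [hset, Finset.sum_pair hne]
  simp only [fourierMatrix, Matrix.of_apply, cycleEnergy, cycleChar]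
  rw [map_sub, map_add, map_one, sub_mul, add_mul, one_mul, AddChar.map_add_eq_mul, sub_eq_add_neg,
    AddChar.map_add_eq_mul, AddChar.map_neg_eq_conj]
  have h2 := Complex.add_conj (ZMod.stdAddChar (ZMod.finEquiv (m + 3) k))
  rw [← h2]
  ring

theorem cycleHamiltonian_eq :
    cycleHamiltonian (m + 3) = fourierMatrix m *
      Matrix.diagonal (fun k => (cycleEnergy m k : ℂ)) * (fourierMatrix m)ᴴ := by
  have h : fourierMatrix m * (fourierMatrix m)ᴴ = 1 :=
    (Unitary.mem_iff.1 (fourierMatrix_mem_unitary m)).2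
  rw [← cycleHamiltonian_mul_fourierMatrix, mul_assoc, h, mul_one]

/-- Summing over the site `a` gives character orthogonality. The factor `n⁻²` collects `n⁻¹` from
the jump normalisation, `n⁻²` from the Fourier entries and `n` from the sum. -/
theorem correlation_localJump (p q : Fin (m + 3) × Fin (m + 3)) :
    correlation (fourierMatrix m) (localJump (m + 3)) p q =
      if p.1 - q.1 = p.2 - q.2 then ((((m + 3 : ℕ) : ℝ) ^ 2)⁻¹ : ℝ) else 0 := by
  have h1 : ∀ (a k l : Fin (m + 3)),
      ((fourierMatrix m)ᴴ * localJump (m + 3) a * fourierMatrix m) k l =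
        ((1 / √((m + 3 : ℕ) : ℝ) : ℝ) : ℂ) * (((m + 3 : ℕ) : ℂ)⁻¹ *
          ZMod.stdAddChar (ZMod.finEquiv (m + 3) a *
            (ZMod.finEquiv (m + 3) l - ZMod.finEquiv (m + 3) k))) := by
    intro a k l
    rw [localJump, Matrix.mul_smul, Matrix.smul_mul, Matrix.smul_apply, smul_eq_mul]
    congr 1
    rw [Matrix.mul_apply, Finset.sum_eq_single a]
    · rw [Matrix.mul_single_apply_same, mul_one]
      rw [Matrix.conjTranspose_apply, fourierMatrix, Matrix.of_apply, Matrix.of_apply, star_mul',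
        mul_mul_mul_comm, mul_sub, sub_eq_neg_add, AddChar.map_add_eq_mul, AddChar.map_neg_eq_conj]
      congr 1
      rw [RCLike.star_def, Complex.conj_ofReal, ← Complex.ofReal_mul, one_div, ← mul_inv,
        Real.mul_self_sqrt (by positivity)]
      push_cast
      rfl
    · intro b _ hb
      rw [Matrix.mul_single_apply_of_ne _ _ _ _ _ hb, zero_mul]
    · simp
  have h2 : ∀ a, ((fourierMatrix m)ᴴ * localJump (m + 3) a * fourierMatrix m) p.1 p.2 *
      star (((fourierMatrix m)ᴴ * localJump (m + 3) a * fourierMatrix m) q.1 q.2) =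
      (((m + 3 : ℕ) : ℂ)⁻¹) ^ 3 * ZMod.stdAddChar (ZMod.finEquiv (m + 3) a *
        ((ZMod.finEquiv (m + 3) p.2 - ZMod.finEquiv (m + 3) p.1) -
          (ZMod.finEquiv (m + 3) q.2 - ZMod.finEquiv (m + 3) q.1))) := by
    intro a
    rw [h1, h1, mul_sub _ (_ - _) (_ - _), sub_eq_add_neg (_ * _), AddChar.map_add_eq_mul,
      AddChar.map_neg_eq_conj]
    have h3 : ((1 / √((m + 3 : ℕ) : ℝ) : ℝ) : ℂ) * ((1 / √((m + 3 : ℕ) : ℝ) : ℝ) : ℂ) =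
        ((m + 3 : ℕ) : ℂ)⁻¹ := by
      rw [← Complex.ofReal_mul, one_div, ← mul_inv, Real.mul_self_sqrt (by positivity)]
      push_cast
      rfl
    rw [star_mul', star_mul', RCLike.star_def, Complex.conj_ofReal, map_inv₀, Complex.conj_natCast,
      pow_three]
    generalize ZMod.stdAddChar (ZMod.finEquiv (m + 3) a *
      (ZMod.finEquiv (m + 3) p.2 - ZMod.finEquiv (m + 3) p.1)) = X,
      ((1 / √((m + 3 : ℕ) : ℝ) : ℝ) : ℂ) = c at h3 ⊢
    generalize (starRingEnd ℂ) _ = Y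
    linear_combination (((m + 3 : ℕ) : ℂ)⁻¹ * ((m + 3 : ℕ) : ℂ)⁻¹ * X * Y) * h3
  rw [correlation]
  simp_rw [h2]
  rw [← Finset.mul_sum, sum_stdAddChar_mul]
  have h4 : (ZMod.finEquiv (m + 3) p.2 - ZMod.finEquiv (m + 3) p.1) -
      (ZMod.finEquiv (m + 3) q.2 - ZMod.finEquiv (m + 3) q.1) = 0 ↔ p.1 - q.1 = p.2 - q.2 := by
    rw [← (ZMod.finEquiv (m + 3)).injective.eq_iff, map_sub, map_sub]
    constructor <;> intro h <;> linear_combination -h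
  simp only [h4]
  have h5 : ((m + 3 : ℕ) : ℂ) ≠ 0 := Nat.cast_ne_zero.2 (Nat.succ_ne_zero _)
  split_ifs
  · push_cast at h5 ⊢
    field_simp
  · simp

theorem charpoly_lindbladian_cycle {β σ : ℝ} (hβ : 0 ≤ β) (hσ : 0 < σ) :
    (lindbladian β σ (cycleHamiltonian (m + 3)) (localJump (m + 3))).charpoly =
      ((rateMatrix β σ (((m + 3 : ℕ) : ℝ) ^ 2)⁻¹ (cycleEnergy m)).map Complex.ofReal).charpoly := by
  rw [cycleHamiltonian_eq, charpoly_lindbladian hβ hσ (fourierMatrix_mem_unitary m)]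
  · congr 1
    ext x y
    simp only [rateMatrix, Matrix.of_apply, Matrix.map_apply, correlation_localJump, sub_self,
      if_true, Complex.ofReal_sub]
    congr 1
    · have h : x.1 - x.2 = y.1 - y.2 ↔ x.1 - y.1 = x.2 - y.2 := by
        rw [sub_eq_sub_iff_add_eq_add, sub_eq_sub_iff_add_eq_add, add_comm y.1]
      simp only [h]
      split_ifs
      · push_cast
        ring
      · simp
    · split_ifs
      · push_cast
        rw [← Finset.sum_add_distrib.symm]
        simp only [← add_mul, ← Finset.sum_mul]
        rw [← Finset.sum_add_distrib]
        ring
      · simp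
  · intro k l l' hl
    rw [correlation_localJump, if_neg, Complex.ofReal_zero]
    intro h
    rw [sub_self, eq_comm, sub_eq_zero] at h
    exact hl h

/-! ### Energy differences on the cycle -/

theorem norm_cycleChar (k : Fin (m + 3)) : ‖cycleChar m k‖ = 1 := AddChar.norm_apply _ _

theorem cycleChar_add (k l : Fin (m + 3)) :
    cycleChar m (k + l) = cycleChar m k * cycleChar m l := by
  rw [cycleChar, map_add, AddChar.map_add_eq_mul]
  rfl

theorem abs_cycleEnergy_le (k : Fin (m + 3)) : |cycleEnergy m k| ≤ 2 := by
  rw [cycleEnergy, abs_mul, abs_two]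
  have := (Complex.abs_re_le_norm (cycleChar m k)).trans_eq (norm_cycleChar m k)
  linarith

theorem norm_one_sub_pow_le {z : ℂ} (hz : ‖z‖ = 1) (i : ℕ) : ‖1 - z ^ i‖ ≤ i * ‖1 - z‖ := by
  induction i with
  | zero => simp
  | succ i ih =>
    have : 1 - z ^ (i + 1) = (1 - z ^ i) + z ^ i * (1 - z) := by ring
    rw [this]
    refine (norm_add_le _ _).trans ?_
    rw [norm_mul, norm_pow, hz, one_pow, one_mul]
    push_cast
    linarith

/-- The powers of `z` sum to zero, so `n = ∑ (1 - z^i)`, and each term has norm at most `n‖1 - z‖`.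
-/
theorem inv_le_norm_one_sub_of_pow_eq_one {z : ℂ} (hz : ‖z‖ = 1) {n : ℕ} (hn : n ≠ 0)
    (hpow : z ^ n = 1) (h1 : z ≠ 1) : (n : ℝ)⁻¹ ≤ ‖1 - z‖ := by
  have hgeom : ∑ i ∈ Finset.range n, z ^ i = 0 := by
    have := mul_geom_sum z n
    rw [hpow, sub_self, mul_eq_zero, sub_eq_zero] at this
    exact this.resolve_left h1
  have hsum : (n : ℂ) = ∑ i ∈ Finset.range n, (1 - z ^ i) := by
    rw [Finset.sum_sub_distrib, hgeom]
    simp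
  have hle : (n : ℝ) ≤ n * (n * ‖1 - z‖) := by
    calc (n : ℝ) = ‖(n : ℂ)‖ := by simp
      _ = ‖∑ i ∈ Finset.range n, (1 - z ^ i)‖ := by rw [← hsum]
      _ ≤ ∑ i ∈ Finset.range n, n * ‖1 - z‖ := by
          refine norm_sum_le_of_le _ fun i hi => (norm_one_sub_pow_le hz i).trans ?_
          have : (i : ℝ) ≤ n := by exact_mod_cast (Finset.mem_range.1 hi).le
          gcongr
      _ = n * (n * ‖1 - z‖) := by simp
  have hn' : (0 : ℝ) < n := by exact_mod_cast Nat.pos_of_ne_zero hn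
  rw [inv_le_iff_one_le_mul₀ hn']
  nlinarith

theorem inv_le_norm_cycleChar_sub {k l : Fin (m + 3)} (hkl : k ≠ l) :
    ((m + 3 : ℕ) : ℝ)⁻¹ ≤ ‖cycleChar m k - cycleChar m l‖ := by
  have h1 : cycleChar m k = cycleChar m l * cycleChar m (k - l) := by
    rw [← cycleChar_add, add_sub_cancel]
  have h2 : ‖cycleChar m k - cycleChar m l‖ = ‖1 - cycleChar m (k - l)‖ := by
    rw [h1, ← mul_sub_one, norm_mul, norm_cycleChar, one_mul, norm_sub_rev]
  rw [h2]
  refine inv_le_norm_one_sub_of_pow_eq_one (norm_cycleChar m _) (Nat.succ_ne_zero _) ?_ ?_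
  · rw [cycleChar, ← AddChar.map_nsmul_eq_pow, nsmul_eq_mul, ZMod.natCast_self, zero_mul,
      AddChar.map_zero_eq_one]
  · intro h
    rw [cycleChar, ← AddChar.map_zero_eq_one (ZMod.stdAddChar (N := m + 3)),
      ZMod.injective_stdAddChar.eq_iff, map_eq_zero_iff _ (ZMod.finEquiv (m + 3)).injective,
      sub_eq_zero] at h
    exact hkl h

theorem sum_cycleChar : ∑ s, cycleChar m s = 0 := by
  have h := sum_stdAddChar_mul m 1
  have h1 : (1 : ZMod (m + 3)) ≠ 0 := fun h => two_ne_zero_zmod m (by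
    rw [← one_add_one_eq_two, h, add_zero])
  rw [if_neg h1] at h
  simpa [cycleChar] using h

theorem sum_cycleChar_sq : ∑ s, cycleChar m s ^ 2 = 0 := by
  have h := sum_stdAddChar_mul m 2
  rw [if_neg (two_ne_zero_zmod m)] at h
  rw [← h]
  refine Finset.sum_congr rfl fun s _ => ?_
  rw [cycleChar, mul_two, AddChar.map_add_eq_mul, sq]

theorem cycleEnergy_sub_eq (k l s : Fin (m + 3)) :
    cycleEnergy m (k + s) - cycleEnergy m (l + s) =
      2 * ((cycleChar m k - cycleChar m l) * cycleChar m s).re := by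
  rw [cycleEnergy, cycleEnergy, cycleChar_add, cycleChar_add, sub_mul, Complex.sub_re]
  ring

theorem sum_cycleEnergy_sub (k l : Fin (m + 3)) :
    ∑ s, (cycleEnergy m (k + s) - cycleEnergy m (l + s)) = 0 := by
  simp_rw [cycleEnergy_sub_eq]
  rw [← Finset.mul_sum, ← Complex.re_sum, ← Finset.mul_sum, sum_cycleChar]
  simp

/-- From `(2 Re z)² = 2|z|² + 2 Re z²`; the oscillating part sums to zero because the squared
character is nontrivial. -/
theorem sum_cycleEnergy_sub_sq (k l : Fin (m + 3)) :
    ∑ s, (cycleEnergy m (k + s) - cycleEnergy m (l + s)) ^ 2 =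
      2 * (m + 3 : ℕ) * ‖cycleChar m k - cycleChar m l‖ ^ 2 := by
  have h : ∀ z : ℂ, (2 * z.re) ^ 2 = 2 * ‖z‖ ^ 2 + 2 * (z ^ 2).re := by
    intro z
    rw [Complex.sq_norm, Complex.normSq_apply, sq z, Complex.mul_re]
    ring
  simp_rw [cycleEnergy_sub_eq, h, Finset.sum_add_distrib, ← Finset.mul_sum, ← Complex.re_sum,
    mul_pow, norm_mul, norm_cycleChar, mul_one, ← Finset.mul_sum, sum_cycleChar_sq]
  simp
  ring

theorem le_sum_sq_energy_shift {k l : Fin (m + 3)} (hkl : k ≠ l) :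
    2 * ((m + 3 : ℕ) : ℝ)⁻¹ ≤ ∑ s, ((cycleEnergy m (k + s) - cycleEnergy m k) -
      (cycleEnergy m (l + s) - cycleEnergy m l)) ^ 2 := by
  -- The cross term vanishes as the energy differences sum to zero over translations, so the
  -- constant offset only adds a nonnegative amount.
  have h1 : ∑ s, ((cycleEnergy m (k + s) - cycleEnergy m k) -
      (cycleEnergy m (l + s) - cycleEnergy m l)) ^ 2 =
      ∑ s, (cycleEnergy m (k + s) - cycleEnergy m (l + s)) ^ 2 +
        (m + 3 : ℕ) * (cycleEnergy m k - cycleEnergy m l) ^ 2 := by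
    have h2 : ∀ s, ((cycleEnergy m (k + s) - cycleEnergy m k) -
      (cycleEnergy m (l + s) - cycleEnergy m l)) ^ 2 =
      (cycleEnergy m (k + s) - cycleEnergy m (l + s)) ^ 2 +
        (cycleEnergy m k - cycleEnergy m l) ^ 2 - 2 * (cycleEnergy m k - cycleEnergy m l) *
          (cycleEnergy m (k + s) - cycleEnergy m (l + s)) := fun s => by ring
    simp_rw [h2]
    rw [Finset.sum_sub_distrib, ← Finset.mul_sum, sum_cycleEnergy_sub, Finset.sum_add_distrib]
    simp
  rw [h1, sum_cycleEnergy_sub_sq]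
  have h3 := inv_le_norm_cycleChar_sub m hkl
  have h4 : (0 : ℝ) < ((m + 3 : ℕ) : ℝ) := by positivity
  have h5 : 2 * ((m + 3 : ℕ) : ℝ)⁻¹ =
      2 * ((m + 3 : ℕ) : ℝ) * (((m + 3 : ℕ) : ℝ)⁻¹) ^ 2 := by
    field_simp
  have h6 : 2 * ((m + 3 : ℕ) : ℝ)⁻¹ ≤
      2 * (m + 3 : ℕ) * ‖cycleChar m k - cycleChar m l‖ ^ 2 := by
    rw [h5]
    gcongr
  have h7 : 0 ≤ ((m + 3 : ℕ) : ℝ) * (cycleEnergy m k - cycleEnergy m l) ^ 2 := by positivity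
  linarith

theorem abs_cycleEnergy_succ_sub_le (k : Fin (m + 3)) :
    |cycleEnergy m (k + 1) - cycleEnergy m k| ≤ 4 * Real.pi * ((m + 3 : ℕ) : ℝ)⁻¹ := by
  have h1 : cycleEnergy m (k + 1) - cycleEnergy m k =
      2 * (cycleChar m k * (cycleChar m 1 - 1)).re := by
    rw [cycleEnergy, cycleEnergy, cycleChar_add, mul_sub_one, Complex.sub_re]
    ring
  have h2 : cycleChar m 1 =
      Complex.exp (Complex.I * ((2 * Real.pi * ((m + 3 : ℕ) : ℝ)⁻¹ : ℝ) : ℂ)) := by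
    rw [cycleChar, map_one, ← Int.cast_one, ZMod.stdAddChar_coe]
    congr 1
    push_cast
    ring
  have h3 : ‖cycleChar m 1 - 1‖ ≤ 2 * Real.pi * ((m + 3 : ℕ) : ℝ)⁻¹ := by
    rw [h2]
    refine Real.norm_exp_I_mul_ofReal_sub_one_le.trans_eq (Real.norm_of_nonneg ?_)
    have := Real.pi_pos
    positivity
  have h4 := Complex.abs_re_le_norm (cycleChar m k * (cycleChar m 1 - 1))
  rw [norm_mul, norm_cycleChar, one_mul] at h4
  rw [h1, abs_mul, abs_two]
  linarith

/-- Neighbouring momenta differ in energy by `O(1/n)`, so each of the `n` squares is `O(1/n²)`. -/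
theorem sum_sq_energy_shift_succ_le (k : Fin (m + 3)) :
    ∑ s, ((cycleEnergy m (k + 1 + s) - cycleEnergy m (k + 1)) -
      (cycleEnergy m (k + s) - cycleEnergy m k)) ^ 2 ≤
        64 * Real.pi ^ 2 * ((m + 3 : ℕ) : ℝ)⁻¹ := by
  have h : ∀ s ∈ Finset.univ, ((cycleEnergy m (k + 1 + s) - cycleEnergy m (k + 1)) -
      (cycleEnergy m (k + s) - cycleEnergy m k)) ^ 2 ≤
        (8 * Real.pi * ((m + 3 : ℕ) : ℝ)⁻¹) ^ 2 := by
    intro s _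
    have h1 := abs_le.1 (abs_cycleEnergy_succ_sub_le m (k + s))
    have h2 := abs_le.1 (abs_cycleEnergy_succ_sub_le m k)
    rw [add_right_comm]
    exact sq_le_sq' (by linarith [h1.1, h2.2]) (by linarith [h1.2, h2.1])
  refine (Finset.sum_le_card_nsmul _ _ _ h).trans_eq ?_
  rw [Finset.card_univ, Fintype.card_fin, nsmul_eq_mul]
  have h4 : ((m + 3 : ℕ) : ℝ) ≠ 0 := by positivity
  field_simp
  norm_num

end Cycle

end CKG

namespace CKG

/-! ### Bounds on the spectral gap -/

theorem spectralGap_cycle_bounds {β σ c c' : ℝ} (hβ : 0 ≤ β) (hσ : 0 < σ) (hc : 0 < c)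
    (hc' : 0 < c') (hθ : ∀ ν, |ν| ≤ 2 * 2 → c * Real.exp (β * 2) ≤ theta β σ ν ν)
    (hθ' : ∀ a b, |a| ≤ 2 * 2 → |b| ≤ 2 * 2 →
      c' * (a - b) ^ 2 ≤ theta β σ a a + theta β σ b b - 2 * theta β σ a b) {m : ℕ}
    (hm : 8 * Real.pi ^ 2 / σ ^ 2 < c * Real.exp (-β * 2) * ((m + 3 : ℕ) : ℝ) ^ 2) :
    min c' (c * Real.exp (-β * 2)) * (((m + 3 : ℕ) : ℝ) ^ 3)⁻¹ ≤
        spectralGap (lindbladian β σ (cycleHamiltonian (m + 3)) (localJump (m + 3))) ∧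
      spectralGap (lindbladian β σ (cycleHamiltonian (m + 3)) (localJump (m + 3))) ≤
        8 * Real.pi ^ 2 / σ ^ 2 * (((m + 3 : ℕ) : ℝ) ^ 3)⁻¹ := by
  set n : ℝ := ((m + 3 : ℕ) : ℝ) with hn
  have hn1 : 1 ≤ n := Nat.one_le_cast.2 (by omega)
  have hn0 : 0 < n := by linarith
  have hκ : 0 ≤ (n ^ 2)⁻¹ := by positivity
  have hoff := fun (x y : Fin (m + 3) × Fin (m + 3)) (hxy : x ≠ y) =>
    deflated_offDiag_nonneg hβ hσ hκ hc.le (abs_cycleEnergy_le m) hθ hxy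
  have hcol := deflated_colSum_le hβ hκ hc.le hc'.le (abs_cycleEnergy_le m) hθ'
    (fun k l hkl => le_sum_sq_energy_shift m hkl)
  have htr := le_traceVec_dotProduct_gibbsVec hβ (mul_nonneg hκ hc.le) (abs_cycleEnergy_le m)
  have hsec := deflated_sectorSum_ge (c := (n ^ 2)⁻¹ * c) hβ hσ hκ
    (one_ne_zero (α := Fin (m + 3))) (sum_sq_energy_shift_succ_le m)
  rw [Fintype.card_fin, ← hn] at hcol htr
  rw [← hn] at hsec
  set δ := min ((n ^ 2)⁻¹ / 2 * (c' * (2 * n⁻¹))) ((n ^ 2)⁻¹ * (n * (c * Real.exp (-β * 2))))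
  set δ' := (n ^ 2)⁻¹ / 2 * (1 / (4 * σ ^ 2) * (64 * Real.pi ^ 2 * n⁻¹)) with hδ'
  -- The coherence rate in `δ` is exactly `c' * n⁻³`; the population rate is of order `n⁻¹`, so
  -- weakening it to `n⁻³` costs nothing.
  have hδ : min c' (c * Real.exp (-β * 2)) * (n ^ 3)⁻¹ ≤ δ := by
    refine le_min ?_ ?_
    · refine (mul_le_mul_of_nonneg_right (min_le_left _ _) (by positivity)).trans_eq ?_
      field_simp
    · refine (mul_le_mul_of_nonneg_right (min_le_right _ _) (by positivity)).trans ?_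
      rw [show (n ^ 2)⁻¹ * (n * (c * Real.exp (-β * 2))) = c * Real.exp (-β * 2) * n⁻¹ by
        field_simp]
      gcongr
      exact le_self_pow₀ hn1 (by norm_num)
  have hδ0 : 0 < δ := by
    refine lt_of_lt_of_le ?_ hδ
    have := Real.exp_pos (-β * 2)
    positivity
  have hδ'eq : δ' = 8 * Real.pi ^ 2 / σ ^ 2 * (n ^ 3)⁻¹ := by
    rw [hδ']
    field_simp
    norm_num
  -- The displaced eigenvalue has modulus at least of order `n⁻¹`; `hm` says `n` is large enough for
  -- this to exceed `δ'`.
  have htr0 : δ' < traceVec (Fin (m + 3)) ⬝ᵥ gibbsVec β ((n ^ 2)⁻¹ * c) (cycleEnergy m) := by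
    refine lt_of_lt_of_le ?_ htr
    rw [hδ'eq]
    refine (mul_lt_mul_of_pos_right hm (by positivity)).trans_eq ?_
    field_simp
  have hδ'0 : 0 ≤ δ' := by
    rw [hδ'eq]
    positivity
  rw [spectralGap, charpoly_lindbladian_cycle m hβ hσ, ← hδ'eq]
  have hleft := traceVec_vecMul_rateMatrix β σ (n ^ 2)⁻¹ (cycleEnergy m)
  obtain ⟨z, hz, hzle⟩ := exists_mem_roots_erase_norm_le hleft hδ0 hoff hcol
    (fun x => Real.exp_pos (-β * (cycleEnergy m x.1 + cycleEnergy m x.2) / 2))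
    (fun x y => deflated_detailedBalance hσ _ _ _ x y)
    ⟨(0 + 1, 0), by simp⟩ hsec htr0
  refine ⟨hδ.trans (le_csInf ⟨_, z, hz, rfl⟩ ?_), le_trans (csInf_le ⟨0, ?_⟩ ⟨z, hz, rfl⟩) hzle⟩
  · rintro _ ⟨w, hw, rfl⟩
    have h1 := re_le_of_mem_roots_erase hleft (hδ'0.trans_lt htr0) hoff hcol hw
    have h2 := (abs_le.1 (Complex.abs_re_le_norm w)).1
    linarith
  · rintro _ ⟨w, _, rfl⟩
    exact norm_nonneg w

end CKG

theorem theorem1 (β : ℝ) (hβ : 0 < β) :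
    ∃ σ : ℝ, 0 < σ ∧
      (fun n : ℕ => CKG.spectralGap (CKG.lindbladian β σ (CKG.cycleHamiltonian n) (CKG.localJump n)))
        =Θ[atTop] (fun n : ℕ => ((n : ℝ) ^ 3)⁻¹) := by
  -- The choice is `σ = 1`. Energies lie in `[-2, 2]`, so Bohr frequencies are bounded by `2 * 2`.
  obtain ⟨c₀, hc₀, hθ⟩ := CKG.exists_le_theta_self hβ.le one_pos (2 * 2)
  obtain ⟨c', hc', hθ'⟩ := CKG.exists_le_theta_defect hβ.le one_pos (2 * 2)
  -- The factor `e^{-2β}` compensates the largest possible Gibbs weight, as deflation requires.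
  set c := c₀ * (Real.exp (β * 2))⁻¹ with hc_def
  have hc : 0 < c := by positivity
  have hθc : ∀ ν, |ν| ≤ 2 * 2 → c * Real.exp (β * 2) ≤ CKG.theta β 1 ν ν := by
    intro ν hν
    rw [hc_def, inv_mul_cancel_right₀ (Real.exp_pos _).ne']
    exact hθ ν hν
  have hb : 0 < c * Real.exp (-β * 2) := mul_pos hc (Real.exp_pos _)
  have hev : ∀ᶠ n : ℕ in atTop, min c' (c * Real.exp (-β * 2)) * ((n : ℝ) ^ 3)⁻¹ ≤
        CKG.spectralGap (CKG.lindbladian β 1 (CKG.cycleHamiltonian n) (CKG.localJump n)) ∧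
      CKG.spectralGap (CKG.lindbladian β 1 (CKG.cycleHamiltonian n) (CKG.localJump n)) ≤
        8 * Real.pi ^ 2 / 1 ^ 2 * ((n : ℝ) ^ 3)⁻¹ := by
    have htend : Tendsto (fun n : ℕ => c * Real.exp (-β * 2) * (n : ℝ) ^ 2) atTop atTop :=
      ((tendsto_pow_atTop two_ne_zero).comp tendsto_natCast_atTop_atTop).const_mul_atTop hb
    filter_upwards [htend.eventually_gt_atTop (8 * Real.pi ^ 2 / 1 ^ 2), eventually_ge_atTop 3]
      with n hn h3
    obtain ⟨m, rfl⟩ := Nat.exists_eq_add_of_le' h3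
    exact CKG.spectralGap_cycle_bounds hβ.le one_pos hc hc' hθc hθ' hn
  have hmin : 0 < min c' (c * Real.exp (-β * 2)) := lt_min hc' hb
  refine ⟨1, one_pos, IsBigO.of_bound (8 * Real.pi ^ 2 / 1 ^ 2) ?_,
    IsBigO.of_bound (min c' (c * Real.exp (-β * 2)))⁻¹ ?_⟩
  · filter_upwards [hev] with n hn
    have h0 : 0 ≤ ((n : ℝ) ^ 3)⁻¹ := by positivity
    rw [Real.norm_of_nonneg h0, Real.norm_of_nonneg ((mul_nonneg hmin.le h0).trans hn.1)]
    exact hn.2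
  · filter_upwards [hev] with n hn
    have h0 : 0 ≤ ((n : ℝ) ^ 3)⁻¹ := by positivity
    rw [Real.norm_of_nonneg h0, Real.norm_of_nonneg ((mul_nonneg hmin.le h0).trans hn.1),
      le_inv_mul_iff₀ hmin]
    exact hn.1
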